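/- **Links.** Let $L=L_1\cup\dots\cup L_\ell\subset S^3\subset\mathbb C^2$ be a link of the form that Algorithm 1 outputs. That is, each component $L_k$ is parametrised by $$\gamma(t)=(z_1(t),z_2(t))=\Big(\tfrac{1+\mathrm iZ(t)}{R(t)},\tfrac{X(t)+\mathrm iY(t)}{R(t)}\Big),\qquad R=\sqrt{1+X^2+Y^2+Z^2},$$ where $X=a_0+\sum_{j=1}^N(a_j\cos jt+b_j\sin jt)$ and $Y=c_0+\sum_{j=1}^N(c_j\cos jt+d_j\sin jt)$ are real trigonometric polynomials such that $(X,Y)$ is balanced ($\sum_{j=1}^N j(a_jd_j-b_jc_j)=0$) and $(X',Y')$ never vanishes, and $Z(t)=Z(0)+\int_0^t(YX'-XY')\,ds$. Moreover each $\gamma$ is injective on $[0,2\pi)$ and the components are pairwise disjoint. (Then $Z$ is a trigonometric polynomial and $L$ is Legendrian.) Let $m_k$ be the maximal degree of $X,Y,Z$ for the $k$-th component. **Polynomials.** For $n\ge0$ and a complex vector $x=(c_{i,j})$ indexed by the pairs $0\le i,j\le n$ with $i+j$ even, put $G_x(z_1,z_2)=\sum c_{i,j}z_1^iz_2^j$.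 **The matrix.** For every $n$ there is a complex matrix $A=A_n$, with columns indexed by those pairs $(i,j)$ and with $4m_kn+1$ rows for each component $L_k$, such that for every $x$ the rows of $Ax$ belonging to $L_k$ are the coefficients of $R^{2n}G_x(z_1(t),z_2(t))$ in the basis $1,\cos t,\sin t,\dots,\cos(2m_knt),\sin(2m_knt)$. These matrices have the following properties. (i) If $x\neq0$ and $Ax=0$, then $G_x$ is a non-zero polynomial of degree at most $2n$ with $G_x|_L=0$. For all sufficiently large $n$ such an $x$ exists. (ii) For a component parametrised by $\gamma$ let $H=\gamma'\cdot v_2+\mathrm i\,\gamma'\cdot v_1$ (magnetic case) or $H=\gamma'\cdot v_1-\mathrm i\,\gamma'\cdot v_2$ (electric case), where $\cdot$ is the inner product of $\mathbb R^4=\mathbb C^2$ and $v_1=(-\overline{z_2},\overline{z_1})$, $v_2=\mathrm iv_1$. For every $n\ge1$, in each of the two cases, there is a vector $y$ whose rows belonging to $L_k$ are the coefficients of $R^{2n}H$ in the same basis, and every solution $x$ of $Ax=y$ has the following property. The polynomial $h=G_x$ has degree at most $2n$, and $\mathbf F=h(\alpha,\beta)\nabla\alpha\times\nabla\beta=\mathbf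 E_t+\mathrm i\mathbf B_t$ is a Bateman field of Hopf type with $L$ as a set of closed field lines of its magnetic (respectively electric) part. Here $$\alpha=\frac{x^2+y^2+z^2-t^2-1+2\mathrm iz}{x^2+y^2+z^2-(t-\mathrm i)^2},\qquad \beta=\frac{2(x-\mathrm iy)}{x^2+y^2+z^2-(t-\mathrm i)^2}.$$ A Bateman field of Hopf type is a field $h(\alpha,\beta)\nabla\alpha\times\nabla\beta$ for this pair, which satisfies $\nabla\alpha\times\nabla\beta=\mathrm i(\partial_t\alpha\nabla\beta-\partial_t\beta\nabla\alpha)$, and a function $h$ holomorphic on a neighbourhood of the image of $(\alpha,\beta)$. That $L\subset S^3$ is a set of closed field lines of $\mathbf V_t\in\{\mathbf E_t,\mathbf B_t\}$ means two things. First, there is a time-independent smooth vector field on $S^3$ that has all components of $L$ as periodic orbits and agrees with the pushforward of $\mathbf V_t$ by $(\alpha,\beta)|_t$ up to a positive real factor, for every $t$. Second, for every $t$ and every component $L_k$ not passing through $(1,0)$ (the point that corresponds to $\infty$), the preimage of $L_k$ under $(\alpha,\beta)|_t:\mathbb R^3\to S^3$ is a periodic orbit of $\mathbf V_t$. -/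

import Mathlib

open Real Set Matrix
open scoped ContDiff

noncomputable section

/-! ## The parametrised Legendrian links -/

/-- The Fourier data of one component: two real trigonometric polynomials
`X(t) = a₀ + ∑_{j=1}^N (a_j cos jt + b_j sin jt)`, `Y(t) = c₀ + ∑_{j=1}^N (c_j cos jt + d_j sin jt)`
(the numbers `b 0`, `d 0` and the coefficients with index above `N` play no role), together with
the initial height `Z(0)`. -/
structure FourierCurve where
  N : ℕ
  a : ℕ → ℝ
  b : ℕ → ℝ
  c : ℕ → ℝ
  d : ℕ → ℝ
  z₀ : ℝ

namespace FourierCurve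

variable (K : FourierCurve)

def X (t : ℝ) : ℝ := ∑ j ∈ Finset.range (K.N + 1), (K.a j * cos (j * t) + K.b j * sin (j * t))

def Y (t : ℝ) : ℝ := ∑ j ∈ Finset.range (K.N + 1), (K.c j * cos (j * t) + K.d j * sin (j * t))

/-- `Z(t) = Z(0) + ∫₀ᵗ (Y X' - X Y')`. -/
def Z (t : ℝ) : ℝ := K.z₀ + ∫ s in (0 : ℝ)..t, (K.Y s * deriv K.X s - K.X s * deriv K.Y s)

/-- `(X, Y)` is a balanced parametrisation. -/
def Balanced : Prop :=
  ∑ j ∈ Finset.Icc 1 K.N, (j : ℝ) * (K.a j * K.d j - K.b j * K.c j) = 0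

def R (t : ℝ) : ℝ := √(1 + K.X t ^ 2 + K.Y t ^ 2 + K.Z t ^ 2)

/-- The curve in `S³ ⊂ ℂ²` obtained from `(1 + iZ, X + iY)` by radial projection. -/
def γ (t : ℝ) : ℂ × ℂ :=
  (⟨1 / K.R t, K.Z t / K.R t⟩, ⟨K.X t / K.R t, K.Y t / K.R t⟩)

/-- The image of the curve: one component of the link. -/
def image : Set (ℂ × ℂ) := range K.γ

end FourierCurve

/-- `f` is a real trigonometric polynomial of degree at most `m`. -/
def IsTrigPolynomial (f : ℝ → ℝ) (m : ℕ) : Prop :=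
  ∃ p q : ℕ → ℝ, ∀ t, f t = ∑ j ∈ Finset.range (m + 1), (p j * cos (j * t) + q j * sin (j * t))

/-- The maximum of the degrees of the trigonometric polynomials `X`, `Y`, `Z`, i.e. the least `m`
such that all three are trigonometric polynomials of degree at most `m`. -/
def FourierCurve.deg (K : FourierCurve) : ℕ :=
  sInf {m | IsTrigPolynomial K.X m ∧ IsTrigPolynomial K.Y m ∧ IsTrigPolynomial K.Z m}

/-- The parametrised links in `S³` with `l` components of the form that the algorithm outputs: each
component comes from a balanced pair of finite Fourier series `(X, Y)` that is a regular plane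
curve, with the third coordinate obtained by integration, and the components are simple closed
curves that are pairwise disjoint. -/
structure FourierLink (l : ℕ) where
  comp : Fin l → FourierCurve
  balanced : ∀ k, (comp k).Balanced
  regular : ∀ k t, (deriv (comp k).X t, deriv (comp k).Y t) ≠ (0, 0)
  simple : ∀ k, InjOn (comp k).γ (Ico 0 (2 * π))
  disjoint : ∀ k k', k ≠ k' → Disjoint (comp k).image (comp k').image

/-- The link as a subset of `S³`. -/
def FourierLink.carrier {l : ℕ} (L : FourierLink l) : Set (ℂ × ℂ) := ⋃ k, (L.comp k).image

/-! ## The linear systems -/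

/-- The unknowns: pairs `(i, j)` with `0 ≤ i, j ≤ n` and `i + j` even. -/
abbrev EvenIndex (n : ℕ) : Type :=
  {p : Fin (n + 1) × Fin (n + 1) // Even ((p.1 : ℕ) + (p.2 : ℕ))}

/-- The polynomial `∑ c_{i,j} z₁ⁱ z₂ʲ` with the given coefficients (and `c_{i,j} = 0` for `i + j`
odd). -/
def polyOf {n : ℕ} (x : EvenIndex n → ℂ) : MvPolynomial (Fin 2) ℂ :=
  ∑ p : EvenIndex n,
    MvPolynomial.C (x p) * MvPolynomial.X 0 ^ (p.1.1 : ℕ) * MvPolynomial.X 1 ^ (p.1.2 : ℕ)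

/-- The function `ℂ² → ℂ` given by a polynomial. -/
def polyFun (G : MvPolynomial (Fin 2) ℂ) (z : ℂ × ℂ) : ℂ := MvPolynomial.eval ![z.1, z.2] G

/-- Indices of the basis `1, cos t, …, cos dt, sin t, …, sin dt`; there are `2d + 1` of them. -/
abbrev TrigIndex (d : ℕ) : Type := Fin (d + 1) ⊕ Fin d

def trigBasis {d : ℕ} : TrigIndex d → ℝ → ℝ
  | .inl k, t => cos ((k : ℕ) * t)
  | .inr k, t => sin (((k : ℕ) + 1) * t)

/-- The equations: `4 m_k n + 1` of them for the component with index `k`, where `m_k` is the degree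
of that component. -/
abbrev Row {l : ℕ} (L : FourierLink l) (n : ℕ) : Type :=
  Σ k : Fin l, TrigIndex (2 * (L.comp k).deg * n)

/-- `v` lists, component by component, the coefficients of the functions `f k` in the trigonometric
basis. -/
def IsTrigExpansion {l : ℕ} (L : FourierLink l) {n : ℕ} (f : Fin l → ℝ → ℂ)
    (v : Row L n → ℂ) : Prop :=
  ∀ k t, f k t = ∑ r : TrigIndex (2 * (L.comp k).deg * n), v ⟨k, r⟩ * (trigBasis r t : ℂ)

/-- `A` is the matrix of the linear map that sends the coefficients of a polynomial `G` to the
coefficients of the trigonometric polynomials `R^{2n} G(z₁(t), z₂(t))`, one for each component. -/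
def IsExpansionMatrix {l : ℕ} (L : FourierLink l) (n : ℕ)
    (A : Matrix (Row L n) (EvenIndex n) ℂ) : Prop :=
  ∀ x : EvenIndex n → ℂ,
    IsTrigExpansion L
      (fun k t => ((L.comp k).R t : ℂ) ^ (2 * n) * polyFun (polyOf x) ((L.comp k).γ t)) (A *ᵥ x)

/-! ## Bateman fields -/

/-- Gradient with respect to the three spatial variables. -/
def grad (f : (Fin 3 → ℝ) → ℂ) (p : Fin 3 → ℝ) : Fin 3 → ℂ :=
  fun i => fderiv ℝ f p (Pi.single i 1)

/-- `α, β` are smooth and `∇α × ∇β = i (∂ₜα ∇β - ∂ₜβ ∇α)`. The first argument is the time. -/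
def IsBatemanPair (α β : ℝ → (Fin 3 → ℝ) → ℂ) : Prop :=
  ContDiff ℝ ∞ (Function.uncurry α) ∧ ContDiff ℝ ∞ (Function.uncurry β) ∧
  ∀ t p, grad (α t) p ⨯₃ grad (β t) p =
    Complex.I • (deriv (fun s => α s p) t • grad (β t) p - deriv (fun s => β s p) t • grad (α t) p)

/-- The field `h(α, β) ∇α × ∇β`. -/
def batemanField (α β : ℝ → (Fin 3 → ℝ) → ℂ) (h : ℂ × ℂ → ℂ) (t : ℝ) (p : Fin 3 → ℝ) :
    Fin 3 → ℂ :=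
  h (α t p, β t p) • (grad (α t) p ⨯₃ grad (β t) p)

/-- `F` is the field `h(α, β) ∇α × ∇β` for a Bateman pair `(α, β)` and a function `h` that is
holomorphic on a neighbourhood of the image of `(α, β)`. -/
def IsBatemanField (α β : ℝ → (Fin 3 → ℝ) → ℂ) (F : ℝ → (Fin 3 → ℝ) → Fin 3 → ℂ) : Prop :=
  IsBatemanPair α β ∧
  ∃ (U : Set (ℂ × ℂ)) (h : ℂ × ℂ → ℂ), IsOpen U ∧ (∀ t p, (α t p, β t p) ∈ U) ∧
    DifferentiableOn ℂ h U ∧ ∀ t p, F t p = batemanField α β h t p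

/-- `α = (x² + y² + z² - t² - 1 + 2iz) / (x² + y² + z² - (t - i)²)`. -/
def hopfα (t : ℝ) (p : Fin 3 → ℝ) : ℂ :=
  ((p 0 : ℂ) ^ 2 + (p 1 : ℂ) ^ 2 + (p 2 : ℂ) ^ 2 - (t : ℂ) ^ 2 - 1 + 2 * Complex.I * (p 2 : ℂ)) /
    ((p 0 : ℂ) ^ 2 + (p 1 : ℂ) ^ 2 + (p 2 : ℂ) ^ 2 - ((t : ℂ) - Complex.I) ^ 2)

/-- `β = 2(x - iy) / (x² + y² + z² - (t - i)²)`. -/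
def hopfβ (t : ℝ) (p : Fin 3 → ℝ) : ℂ :=
  (2 * ((p 0 : ℂ) - Complex.I * (p 1 : ℂ))) /
    ((p 0 : ℂ) ^ 2 + (p 1 : ℂ) ^ 2 + (p 2 : ℂ) ^ 2 - ((t : ℂ) - Complex.I) ^ 2)

/-- The map `(α, β)` at time `t`, which identifies `ℝ³` with `S³` minus the point `(1, 0)`; the
projection `φₜ : S³ → ℝ³ ∪ {∞}` is its inverse. -/
def hopfMap (t : ℝ) (p : Fin 3 → ℝ) : ℂ × ℂ := (hopfα t p, hopfβ t p)

/-- A Bateman field of Hopf type. -/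
def IsBatemanFieldOfHopfType (F : ℝ → (Fin 3 → ℝ) → Fin 3 → ℂ) : Prop :=
  IsBatemanField hopfα hopfβ F

/-- The two parts of an electromagnetic field `F = E + iB`. -/
inductive FieldPart
  | electric
  | magnetic

def FieldPart.of : FieldPart → (ℝ → (Fin 3 → ℝ) → Fin 3 → ℂ) → ℝ → (Fin 3 → ℝ) → Fin 3 → ℝ
  | .electric, F, t, p => fun i => (F t p i).re
  | .magnetic, F, t, p => fun i => (F t p i).im

/-- `C` is a closed field line (a periodic orbit, not a rest point) of the vector field `V`. -/
def IsClosedFieldLine {E : Type*} [NormedAddCommGroup E] [NormedSpace ℝ E]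
    (V : E → E) (C : Set E) : Prop :=
  ∃ (T : ℝ) (c : ℝ → E), 0 < T ∧ (∀ s, HasDerivAt c (V (c s)) s) ∧ Function.Periodic c T ∧
    InjOn c (Ico 0 T) ∧ range c = C

/-- `W` is a time-independent smooth vector field on `S³` (extended to `ℂ²`) such that, at every
time `t`, the field `V t` on `ℝ³` is the pushforward of `W` by `φₜ`, up to a positive real factor. -/
def IsSphereField (V : ℝ → (Fin 3 → ℝ) → Fin 3 → ℝ) (W : ℂ × ℂ → ℂ × ℂ) : Prop :=
  ContDiff ℝ ∞ W ∧
  ∀ t p, ∃ ρ : ℝ, 0 < ρ ∧ fderiv ℝ (hopfMap t) p (V t p) = ρ • W (hopfMap t p)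

/-- The components of `L ⊂ S³` are closed field lines of the time-dependent field `V` on `ℝ³`:
they are periodic orbits of the corresponding field on `S³`, and at every time `t` the projection
`φₜ(K)` of a component `K` is a periodic orbit of `V t` in `ℝ³`, unless `K` passes through the point
`(1, 0)` that is projected to infinity. -/
def HasClosedFieldLines {l : ℕ} (V : ℝ → (Fin 3 → ℝ) → Fin 3 → ℝ) (L : FourierLink l) : Prop :=
  (∃ W, IsSphereField V W ∧ ∀ k, IsClosedFieldLine W (L.comp k).image) ∧
  ∀ t k, ((1, 0) : ℂ × ℂ) ∉ (L.comp k).image →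
    IsClosedFieldLine (V t) (hopfMap t ⁻¹' (L.comp k).image)

/-! ## The inhomogeneous term -/

/-- The standard real inner product on `ℂ² = ℝ⁴`. -/
def realDot (u w : ℂ × ℂ) : ℝ :=
  u.1.re * w.1.re + u.1.im * w.1.im + u.2.re * w.2.re + u.2.im * w.2.im

/-- `v₁ = -x₂ ∂_{x₁} + y₂ ∂_{y₁} + x₁ ∂_{x₂} - y₁ ∂_{y₂}`. -/
def v₁ (z : ℂ × ℂ) : ℂ × ℂ := (⟨-z.2.re, z.2.im⟩, ⟨z.1.re, -z.1.im⟩)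

/-- `v₂ = -y₂ ∂_{x₁} - x₂ ∂_{y₁} + y₁ ∂_{x₂} + x₁ ∂_{y₂}`. -/
def v₂ (z : ℂ × ℂ) : ℂ × ℂ := (⟨-z.2.im, -z.2.re⟩, ⟨z.1.im, z.1.re⟩)

/-- The function `H` on the link, as a function of the parameter: `T · v₂ + i T · v₁` for magnetic
field lines and `T · v₁ - i T · v₂` for electric ones, where `T` is the tangent vector of the
parametrisation. -/
def targetH (part : FieldPart) (K : FourierCurve) (t : ℝ) : ℂ :=
  match part with
  | .magnetic => ⟨realDot (deriv K.γ t) (v₂ (K.γ t)), realDot (deriv K.γ t) (v₁ (K.γ t))⟩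
  | .electric => ⟨realDot (deriv K.γ t) (v₁ (K.γ t)), -realDot (deriv K.γ t) (v₂ (K.γ t))⟩

end

/-!
Being Legendrian means that the velocity `γ'` of a component is a complex multiple of the vector
field `v₁`; up to the conjugation and the phase that distinguish `E` from `B`, that multiple is `H`.
On the other hand the differential of `(α, β)` sends the electric or magnetic part of
`h(α, β) ∇α × ∇β` to a positive multiple of `conj h • v₁`, up to the same phase. Hence `h = H` on
`L` makes every `γ` an integral curve on `S³`, and after a change of time its preimage is one in
`ℝ³`.

Since `R ^ 2` and the numerators of `γ` are trigonometric polynomials, the factor `R ^ (2 * n)`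
clears the denominators of `h` and `H` along `γ` (this is why only even `i + j` are admitted), and
`h = 0` and `h = H` become linear systems. Their number of equations is linear in `n` while the
number of unknowns is quadratic.
-/

/-! ## Real trigonometric polynomials -/

/-- The oscillation of frequency `ν` with amplitudes `p` and `q`, one term of a Fourier sum. -/
noncomputable def trigMode (p q ν t : ℝ) : ℝ := p * cos (ν * t) + q * sin (ν * t)

/-- The trigonometric polynomial of degree at most `N` with given Fourier coefficients, which makes
the sums in `FourierCurve.X`, `FourierCurve.Y` and `IsTrigPolynomial` available as functions of
their coefficients; `q 0` is immaterial. -/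
noncomputable def trigSum (N : ℕ) (p q : ℕ → ℝ) (t : ℝ) : ℝ :=
  ∑ j ∈ Finset.range (N + 1), trigMode (p j) (q j) j t

theorem continuous_trigMode (p q ν : ℝ) : Continuous (trigMode p q ν) := by
  unfold trigMode
  fun_prop

theorem hasDerivAt_trigMode (p q ν t : ℝ) :
    HasDerivAt (trigMode p q ν) (trigMode (ν * q) (-(ν * p)) ν t) t := by
  have hν : HasDerivAt (fun t => ν * t) ν t := by simpa using (hasDerivAt_id t).const_mul ν
  refine ((hν.cos.const_mul p).add (hν.sin.const_mul q)).congr_deriv ?_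
  simp only [trigMode]
  ring

theorem hasDerivAt_trigSum (N : ℕ) (p q : ℕ → ℝ) (t : ℝ) :
    HasDerivAt (trigSum N p q) (trigSum N (fun j => j * q j) (fun j => -(j * p j)) t) t :=
  HasDerivAt.fun_sum fun j _ => hasDerivAt_trigMode (p j) (q j) j t

theorem continuous_trigSum (N : ℕ) (p q : ℕ → ℝ) : Continuous (trigSum N p q) :=
  continuous_finsetSum _ fun j _ => continuous_trigMode (p j) (q j) j

theorem periodic_trigSum (N : ℕ) (p q : ℕ → ℝ) : Function.Periodic (trigSum N p q) (2 * π) := by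
  intro t
  simp only [trigSum, trigMode, mul_add, cos_add_nat_mul_two_pi, sin_add_nat_mul_two_pi]

theorem trigMode_mul (p q ν r s η t : ℝ) :
    trigMode p q ν t * trigMode r s η t =
      trigMode ((p * r - q * s) / 2) ((p * s + q * r) / 2) (ν + η) t +
        trigMode ((p * r + q * s) / 2) ((q * r - p * s) / 2) (ν - η) t := by
  simp only [trigMode, add_mul, sub_mul, cos_add, sin_add, cos_sub, sin_sub]
  ring

theorem integral_trigMode (p q : ℝ) (n : ℤ) :
    ∫ t in (0 : ℝ)..(2 * π), trigMode p q n t = if n = 0 then 2 * π * p else 0 := by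
  split_ifs with hn
  · simp [hn, trigMode]
  have hn' : (n : ℝ) ≠ 0 := Int.cast_ne_zero.2 hn
  have hprim (t : ℝ) : HasDerivAt (trigMode (-(q / n)) (p / n) n) (trigMode p q n t) t := by
    refine (hasDerivAt_trigMode _ _ _ t).congr_deriv ?_
    rw [mul_neg, neg_neg, mul_div_cancel₀ _ hn', mul_div_cancel₀ _ hn']
  rw [intervalIntegral.integral_eq_sub_of_hasDerivAt (fun t _ => hprim t)
    ((continuous_trigMode p q n).intervalIntegrable _ _)]
  have hsin : sin (n * (2 * π)) = 0 := by simpa using sin_add_int_mul_two_pi 0 n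
  simp [trigMode, hsin]

theorem integral_trigMode_mul (p q r s : ℝ) (j k : ℕ) :
    ∫ t in (0 : ℝ)..(2 * π), trigMode p q j t * trigMode r s k t =
      if j = k then if j = 0 then 2 * π * (p * r) else π * (p * r + q * s) else 0 := by
  have hsum := integral_trigMode ((p * r - q * s) / 2) ((p * s + q * r) / 2) (j + k)
  have hdiff := integral_trigMode ((p * r + q * s) / 2) ((q * r - p * s) / 2) (j - k)
  push_cast at hsum hdiff
  simp only [trigMode_mul]
  rw [intervalIntegral.integral_add ((continuous_trigMode _ _ _).intervalIntegrable _ _)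
    ((continuous_trigMode _ _ _).intervalIntegrable _ _), hsum, hdiff]
  split_ifs <;> first | omega | ring

theorem integral_trigSum_mul_trigSum (N : ℕ) (p q r s : ℕ → ℝ) :
    ∫ t in (0 : ℝ)..(2 * π), trigSum N p q t * trigSum N r s t =
      2 * π * (p 0 * r 0) + π * ∑ j ∈ Finset.Icc 1 N, (p j * r j + q j * s j) := by
  have hint (j k : ℕ) : IntervalIntegrable
      (fun t => trigMode (p j) (q j) j t * trigMode (r k) (s k) k t) MeasureTheory.volume
      0 (2 * π) :=
    ((continuous_trigMode _ _ _).mul (continuous_trigMode _ _ _)).intervalIntegrable _ _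
  calc ∫ t in (0 : ℝ)..(2 * π), trigSum N p q t * trigSum N r s t
      = ∑ j ∈ Finset.range (N + 1), ∑ k ∈ Finset.range (N + 1),
          ∫ t in (0 : ℝ)..(2 * π), trigMode (p j) (q j) j t * trigMode (r k) (s k) k t := by
        simp only [trigSum, Finset.sum_mul_sum, ← Finset.sum_product']
        exact intervalIntegral.integral_finsetSum fun jk _ => hint jk.1 jk.2
    _ = ∑ j ∈ Finset.range (N + 1),
          if j = 0 then 2 * π * (p j * r j) else π * (p j * r j + q j * s j) := by
        refine Finset.sum_congr rfl fun j hj => ?_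
        simp only [integral_trigMode_mul, Finset.sum_ite_eq, if_pos hj]
    _ = _ := by
        rw [Finset.range_eq_Ico, Finset.sum_eq_sum_Ico_succ_bot N.succ_pos, if_pos rfl,
          Finset.mul_sum]
        refine congrArg _ (Finset.sum_congr (by ext; simp) fun j hj => ?_)
        exact if_neg (Nat.one_le_iff_ne_zero.1 (Finset.mem_Icc.1 hj).1)

/-- For `j = 0` the coefficients of the primitive are `0`, by the convention `x / 0 = 0`. -/
theorem hasDerivAt_trigSum_div (N : ℕ) (p q : ℕ → ℝ) (t : ℝ) :
    HasDerivAt (trigSum N (fun j => -(q j / j)) (fun j => p j / j)) (trigSum N p q t - p 0) t := by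
  refine (hasDerivAt_trigSum _ _ _ t).congr_deriv ?_
  have hmode (j : ℕ) (hj : ((j + 1 : ℕ) : ℝ) ≠ 0) :
      trigMode ((j + 1 : ℕ) * (p (j + 1) / (j + 1 : ℕ)))
        (-((j + 1 : ℕ) * -(q (j + 1) / (j + 1 : ℕ)))) (j + 1 : ℕ) t =
      trigMode (p (j + 1)) (q (j + 1)) (j + 1 : ℕ) t := by
    rw [mul_neg, neg_neg, mul_div_cancel₀ _ hj, mul_div_cancel₀ _ hj]
  simp only [trigSum, Finset.sum_range_succ', hmode _ (Nat.cast_ne_zero.2 (Nat.succ_ne_zero _))]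
  simp [trigMode]

theorem integral_trigSum_eq_sub {N : ℕ} {p q : ℕ → ℝ}
    (h₀ : ∫ t in (0 : ℝ)..(2 * π), trigSum N p q t = 0) (t : ℝ) :
    ∫ s in (0 : ℝ)..t, trigSum N p q s =
      trigSum N (fun j => -(q j / j)) (fun j => p j / j) t -
        trigSum N (fun j => -(q j / j)) (fun j => p j / j) 0 := by
  set g := trigSum N (fun j => -(q j / j)) (fun j => p j / j)
  have hg (t : ℝ) : ∫ s in (0 : ℝ)..t, trigSum N p q s = g t - g 0 + t * p 0 := by
    have hint := (continuous_trigSum N p q).intervalIntegrable (μ := MeasureTheory.volume) 0 t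
    have h := intervalIntegral.integral_eq_sub_of_hasDerivAt (a := 0) (b := t)
      (fun s _ => hasDerivAt_trigSum_div N p q s) (hint.sub (by simp))
    rw [intervalIntegral.integral_sub hint (by simp), intervalIntegral.integral_const,
      sub_zero, smul_eq_mul] at h
    linarith
  have hp : p 0 = 0 := by
    have hper : g (2 * π) = g 0 := by
      simpa using periodic_trigSum N (fun j => -(q j / j)) (fun j => p j / j) 0
    have h := hg (2 * π)
    rw [h₀, hper, sub_self, zero_add] at h
    exact (mul_eq_zero.1 h.symm).resolve_left two_pi_pos.ne'
  rw [hg, hp, mul_zero, add_zero]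

theorem isTrigPolynomial_trigSum (m : ℕ) (p q : ℕ → ℝ) : IsTrigPolynomial (trigSum m p q) m :=
  ⟨p, q, fun _ => rfl⟩

namespace IsTrigPolynomial

variable {f : ℝ → ℝ} {m : ℕ}

theorem exists_eq_trigSum (h : IsTrigPolynomial f m) : ∃ p q, f = trigSum m p q :=
  let ⟨p, q, hf⟩ := h
  ⟨p, q, funext hf⟩

theorem periodic (h : IsTrigPolynomial f m) : Function.Periodic f (2 * π) := by
  obtain ⟨p, q, rfl⟩ := h.exists_eq_trigSum
  exact periodic_trigSum m p q

theorem continuous (h : IsTrigPolynomial f m) : Continuous f := by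
  obtain ⟨p, q, rfl⟩ := h.exists_eq_trigSum
  exact continuous_trigSum m p q

theorem differentiable (h : IsTrigPolynomial f m) : Differentiable ℝ f := by
  obtain ⟨p, q, rfl⟩ := h.exists_eq_trigSum
  exact fun t => (hasDerivAt_trigSum m p q t).differentiableAt

theorem deriv (h : IsTrigPolynomial f m) : IsTrigPolynomial (deriv f) m := by
  obtain ⟨p, q, rfl⟩ := h.exists_eq_trigSum
  rw [funext fun t => (hasDerivAt_trigSum m p q t).deriv]
  exact isTrigPolynomial_trigSum m _ _

theorem exists_integral_eq_sub (h : IsTrigPolynomial f m)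
    (h₀ : ∫ t in (0 : ℝ)..(2 * π), f t = 0) :
    ∃ g, IsTrigPolynomial g m ∧ ∀ t, ∫ s in (0 : ℝ)..t, f s = g t - g 0 := by
  obtain ⟨p, q, rfl⟩ := h.exists_eq_trigSum
  exact ⟨_, isTrigPolynomial_trigSum m _ _, integral_trigSum_eq_sub h₀⟩

end IsTrigPolynomial

/-! ## Complex trigonometric polynomials -/

/-- The exponential `t ↦ exp (i j t)`. -/
noncomputable def expMode (j : ℤ) : ℝ → ℂ := fun t => Complex.exp ((j : ℂ) * t * Complex.I)

/-- Complex trigonometric polynomials of degree at most `m`. -/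
noncomputable def trigSpan (m : ℕ) : Submodule ℂ (ℝ → ℂ) :=
  Submodule.span ℂ (expMode '' {j : ℤ | |j| ≤ m})

theorem expMode_mem_trigSpan {j : ℤ} {m : ℕ} (h : |j| ≤ m) : expMode j ∈ trigSpan m :=
  Submodule.subset_span ⟨j, h, rfl⟩

theorem expMode_mul (j k : ℤ) : expMode j * expMode k = expMode (j + k) := by
  funext t
  simp only [expMode, Pi.mul_apply, ← Complex.exp_add]
  congr 1
  push_cast
  ring

theorem trigSpan_mono {m m' : ℕ} (h : m ≤ m') : trigSpan m ≤ trigSpan m' :=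
  Submodule.span_mono <| Set.image_mono fun j (hj : |j| ≤ m) =>
    (hj.trans (Nat.cast_le.2 h) : |j| ≤ m')

theorem mul_mem_trigSpan {m m' : ℕ} {f g : ℝ → ℂ} (hf : f ∈ trigSpan m) (hg : g ∈ trigSpan m') :
    f * g ∈ trigSpan (m + m') := by
  have hmul : trigSpan m * trigSpan m' ≤ trigSpan (m + m') := by
    rw [trigSpan, trigSpan, Submodule.span_mul_span, Submodule.span_le]
    rintro _ ⟨_, ⟨j, hj, rfl⟩, _, ⟨k, hk, rfl⟩, rfl⟩
    simp only [expMode_mul]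
    exact expMode_mem_trigSpan ((abs_add_le j k).trans (by push_cast; exact add_le_add hj hk))
  exact hmul (Submodule.mul_mem_mul hf hg)

theorem const_mem_trigSpan (c : ℂ) (m : ℕ) : (fun _ => c) ∈ trigSpan m := by
  have hc : (fun _ : ℝ => c) = c • expMode 0 := by
    funext t
    simp [expMode]
  rw [hc]
  exact Submodule.smul_mem _ _ (expMode_mem_trigSpan (by simp))

theorem pow_mem_trigSpan {m : ℕ} {f : ℝ → ℂ} (hf : f ∈ trigSpan m) (k : ℕ) :
    f ^ k ∈ trigSpan (m * k) := by
  induction k with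
  | zero => exact const_mem_trigSpan 1 _
  | succ k ih => rw [pow_succ, mul_add, mul_one]; exact mul_mem_trigSpan ih hf

theorem star_mem_trigSpan {m : ℕ} {f : ℝ → ℂ} (hf : f ∈ trigSpan m) : star f ∈ trigSpan m := by
  induction hf using Submodule.span_induction with
  | mem _ h =>
    obtain ⟨j, hj, rfl⟩ := h
    have hstar : star (expMode j) = expMode (-j) := by
      funext t
      simp [expMode, ← Complex.exp_conj]
    rw [hstar]
    exact expMode_mem_trigSpan ((abs_neg j).trans_le hj)
  | zero => simp
  | add f g _ _ hf hg => simpa using add_mem hf hg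
  | smul c f _ hf => simpa using Submodule.smul_mem _ (star c) hf

theorem cos_mem_trigSpan {j m : ℕ} (h : j ≤ m) :
    (fun t : ℝ => (cos (j * t) : ℂ)) ∈ trigSpan m := by
  have hcos : (fun t : ℝ => (cos (j * t) : ℂ)) = (1 / 2 : ℂ) • (expMode j + expMode (-j)) := by
    funext t
    simp only [expMode, Pi.smul_apply, Pi.add_apply, smul_eq_mul, Complex.ofReal_cos, Complex.cos]
    push_cast
    ring_nf
  rw [hcos]
  exact Submodule.smul_mem _ _ (add_mem (expMode_mem_trigSpan (by simpa using h))
    (expMode_mem_trigSpan (by simpa using h)))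

theorem sin_mem_trigSpan {j m : ℕ} (h : j ≤ m) :
    (fun t : ℝ => (sin (j * t) : ℂ)) ∈ trigSpan m := by
  have hsin : (fun t : ℝ => (sin (j * t) : ℂ)) =
      (Complex.I / 2 : ℂ) • (expMode (-j) - expMode j) := by
    funext t
    simp only [expMode, Pi.smul_apply, Pi.sub_apply, smul_eq_mul, Complex.ofReal_sin, Complex.sin]
    push_cast
    ring_nf
  rw [hsin]
  exact Submodule.smul_mem _ _ (sub_mem (expMode_mem_trigSpan (by simpa using h))
    (expMode_mem_trigSpan (by simpa using h)))

theorem exists_expMode_eq_cos_add_sin (j : ℤ) :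
    ∃ c : ℂ, expMode j = (fun t : ℝ => (cos (j.natAbs * t) : ℂ)) +
      c • fun t : ℝ => (sin (j.natAbs * t) : ℂ) := by
  obtain ⟨k, rfl | rfl⟩ := j.eq_nat_or_neg
  · refine ⟨Complex.I, funext fun t => ?_⟩
    simp only [expMode, Int.cast_natCast, Complex.exp_mul_I, Int.natAbs_natCast, Pi.add_apply,
      Pi.smul_apply, smul_eq_mul]
    push_cast
    ring
  · refine ⟨-Complex.I, funext fun t => ?_⟩
    have hneg : ((-k : ℤ) : ℂ) * t * Complex.I = -(k * t) * Complex.I := by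
      push_cast
      ring
    simp only [expMode, hneg, Complex.exp_mul_I, Complex.cos_neg, Complex.sin_neg, Int.natAbs_neg,
      Int.natAbs_natCast, Pi.add_apply, Pi.smul_apply, smul_eq_mul]
    push_cast
    ring

theorem expMode_mem_span_trigBasis {d : ℕ} {j : ℤ} (hj : |j| ≤ d) :
    expMode j ∈ Submodule.span ℂ (range fun (r : TrigIndex d) (t : ℝ) => (trigBasis r t : ℂ)) := by
  have hd : j.natAbs ≤ d := by rwa [Int.abs_eq_natAbs, Nat.cast_le] at hj
  obtain ⟨c, hc⟩ := exists_expMode_eq_cos_add_sin j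
  rw [hc]
  refine add_mem (Submodule.subset_span ⟨.inl ⟨j.natAbs, Nat.lt_succ_of_le hd⟩, rfl⟩)
    (Submodule.smul_mem _ _ ?_)
  rcases Nat.eq_zero_or_pos j.natAbs with h₀ | h₀
  · simp only [h₀, Nat.cast_zero, zero_mul, sin_zero, Complex.ofReal_zero]
    exact zero_mem _
  · refine Submodule.subset_span ⟨.inr ⟨j.natAbs - 1, by omega⟩, funext fun t => ?_⟩
    have hpred : ((j.natAbs - 1 : ℕ) : ℝ) + 1 = j.natAbs := by
      exact_mod_cast Nat.sub_add_cancel h₀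
    simp only [trigBasis, hpred]

theorem exists_trigBasis_expansion {d : ℕ} {f : ℝ → ℂ} (hf : f ∈ trigSpan d) :
    ∃ v : TrigIndex d → ℂ, ∀ t, f t = ∑ r, v r * (trigBasis r t : ℂ) := by
  have hle : trigSpan d ≤
      Submodule.span ℂ (range fun (r : TrigIndex d) (t : ℝ) => (trigBasis r t : ℂ)) := by
    rw [trigSpan, Submodule.span_le]
    rintro _ ⟨j, hj, rfl⟩
    exact expMode_mem_span_trigBasis hj
  obtain ⟨v, rfl⟩ := (Submodule.mem_span_range_iff_exists_fun ℂ).1 (hle hf)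
  exact ⟨v, fun t => by simp⟩

theorem IsTrigPolynomial.mem_trigSpan {f : ℝ → ℝ} {m : ℕ} (h : IsTrigPolynomial f m) :
    (fun t => (f t : ℂ)) ∈ trigSpan m := by
  obtain ⟨p, q, hf⟩ := h
  have hsum : (fun t => (f t : ℂ)) = ∑ j ∈ Finset.range (m + 1),
      ((p j : ℂ) • (fun t : ℝ => (cos (j * t) : ℂ)) +
        (q j : ℂ) • (fun t : ℝ => (sin (j * t) : ℂ))) := by
    funext t
    simp [hf]
  rw [hsum]
  refine sum_mem fun j hj => ?_
  have hjm : j ≤ m := Finset.mem_range_succ_iff.1 hj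
  exact add_mem (Submodule.smul_mem _ _ (cos_mem_trigSpan hjm))
    (Submodule.smul_mem _ _ (sin_mem_trigSpan hjm))

theorem isTrigPolynomial_iff_mem_trigSpan {f : ℝ → ℝ} {m : ℕ} :
    IsTrigPolynomial f m ↔ (fun t => (f t : ℂ)) ∈ trigSpan m := by
  refine ⟨IsTrigPolynomial.mem_trigSpan, fun h => ?_⟩
  obtain ⟨v, hv⟩ := exists_trigBasis_expansion h
  refine ⟨fun j => if hj : j < m + 1 then (v (.inl ⟨j, hj⟩)).re else 0,
    fun j => if hj : j - 1 < m then (v (.inr ⟨j - 1, hj⟩)).re else 0, fun t => ?_⟩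
  have hre := congrArg Complex.re (hv t)
  simp only [Complex.ofReal_re, Complex.re_sum, Complex.re_mul_ofReal] at hre
  rw [hre, Fintype.sum_sum_type, Finset.sum_add_distrib, Finset.sum_range, Finset.sum_range,
    Fin.sum_univ_succ (n := m) (f := fun j => _ * sin _)]
  simp [trigBasis, Fin.is_le]

namespace IsTrigPolynomial

variable {f g : ℝ → ℝ} {m m' : ℕ}

theorem mono (h : IsTrigPolynomial f m) (hm : m ≤ m') : IsTrigPolynomial f m' :=
  isTrigPolynomial_iff_mem_trigSpan.2 (trigSpan_mono hm h.mem_trigSpan)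

theorem const_add (c : ℝ) (h : IsTrigPolynomial f m) : IsTrigPolynomial (fun t => c + f t) m := by
  rw [isTrigPolynomial_iff_mem_trigSpan]
  simpa using! add_mem (const_mem_trigSpan c m) h.mem_trigSpan

theorem sub (hf : IsTrigPolynomial f m) (hg : IsTrigPolynomial g m) :
    IsTrigPolynomial (fun t => f t - g t) m := by
  rw [isTrigPolynomial_iff_mem_trigSpan]
  simpa using! sub_mem hf.mem_trigSpan hg.mem_trigSpan

theorem mul (hf : IsTrigPolynomial f m) (hg : IsTrigPolynomial g m') :
    IsTrigPolynomial (fun t => f t * g t) (m + m') := by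
  rw [isTrigPolynomial_iff_mem_trigSpan]
  simpa using! mul_mem_trigSpan hf.mem_trigSpan hg.mem_trigSpan

end IsTrigPolynomial

/-! ## The coordinate functions of the curve -/

namespace FourierCurve

variable (K : FourierCurve)

theorem isTrigPolynomial_X : IsTrigPolynomial K.X K.N := isTrigPolynomial_trigSum K.N K.a K.b

theorem isTrigPolynomial_Y : IsTrigPolynomial K.Y K.N := isTrigPolynomial_trigSum K.N K.c K.d

theorem hasDerivAt_X (t : ℝ) : HasDerivAt K.X (deriv K.X t) t :=
  (K.isTrigPolynomial_X.differentiable t).hasDerivAt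

theorem hasDerivAt_Y (t : ℝ) : HasDerivAt K.Y (deriv K.Y t) t :=
  (K.isTrigPolynomial_Y.differentiable t).hasDerivAt

theorem isTrigPolynomial_deriv_Z :
    IsTrigPolynomial (fun s => K.Y s * deriv K.X s - K.X s * deriv K.Y s) (K.N + K.N) :=
  (K.isTrigPolynomial_Y.mul K.isTrigPolynomial_X.deriv).sub
    (K.isTrigPolynomial_X.mul K.isTrigPolynomial_Y.deriv)

theorem hasDerivAt_Z (t : ℝ) :
    HasDerivAt K.Z (K.Y t * deriv K.X t - K.X t * deriv K.Y t) t :=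
  (K.isTrigPolynomial_deriv_Z.continuous.integral_hasStrictDerivAt 0 t).hasDerivAt.const_add K.z₀

theorem integral_deriv_Z :
    ∫ s in (0 : ℝ)..(2 * π), (K.Y s * deriv K.X s - K.X s * deriv K.Y s) =
      -(2 * π) * ∑ j ∈ Finset.Icc 1 K.N, (j : ℝ) * (K.a j * K.d j - K.b j * K.c j) := by
  have hX : deriv K.X = trigSum K.N (fun j => j * K.b j) (fun j => -(j * K.a j)) :=
    funext fun t => (hasDerivAt_trigSum K.N K.a K.b t).deriv
  have hY : deriv K.Y = trigSum K.N (fun j => j * K.d j) (fun j => -(j * K.c j)) :=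
    funext fun t => (hasDerivAt_trigSum K.N K.c K.d t).deriv
  rw [intervalIntegral.integral_sub
    ((K.isTrigPolynomial_Y.mul K.isTrigPolynomial_X.deriv).continuous.intervalIntegrable _ _)
    ((K.isTrigPolynomial_X.mul K.isTrigPolynomial_Y.deriv).continuous.intervalIntegrable _ _),
    hX, hY]
  refine (congrArg₂ (· - ·) (integral_trigSum_mul_trigSum K.N K.c K.d _ _)
    (integral_trigSum_mul_trigSum K.N K.a K.b _ _)).trans ?_
  simp only [Nat.cast_zero, zero_mul, mul_zero, zero_add, ← mul_sub, ← Finset.sum_sub_distrib,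
    Finset.mul_sum]
  exact Finset.sum_congr rfl fun j _ => by ring

variable {K}

theorem Balanced.isTrigPolynomial_Z (hK : K.Balanced) : IsTrigPolynomial K.Z (K.N + K.N) := by
  have h₀ := K.integral_deriv_Z
  rw [show ∑ j ∈ Finset.Icc 1 K.N, _ = _ from hK, mul_zero] at h₀
  obtain ⟨g, hg, hint⟩ := K.isTrigPolynomial_deriv_Z.exists_integral_eq_sub h₀
  have hZ : K.Z = fun t => (K.z₀ - g 0) + g t := by
    funext t
    rw [Z, hint]
    ring
  rw [hZ]
  exact hg.const_add _

theorem Balanced.isTrigPolynomial_deg (hK : K.Balanced) :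
    IsTrigPolynomial K.X K.deg ∧ IsTrigPolynomial K.Y K.deg ∧ IsTrigPolynomial K.Z K.deg :=
  Nat.sInf_mem (s := {m | IsTrigPolynomial K.X m ∧ IsTrigPolynomial K.Y m ∧
    IsTrigPolynomial K.Z m}) ⟨K.N + K.N, K.isTrigPolynomial_X.mono (Nat.le_add_left _ _),
    K.isTrigPolynomial_Y.mono (Nat.le_add_left _ _), hK.isTrigPolynomial_Z⟩

theorem Balanced.periodic_γ (hK : K.Balanced) : Function.Periodic K.γ (2 * π) := by
  intro t
  simp only [γ, R, K.isTrigPolynomial_X.periodic t, K.isTrigPolynomial_Y.periodic t,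
    hK.isTrigPolynomial_Z.periodic t]

end FourierCurve

/-! ## The Hopf pair -/

/-- The common denominator `x² + y² + z² - (t - i)²` of the two functions of the Hopf pair. -/
noncomputable def hopfDen (t : ℝ) (p : Fin 3 → ℝ) : ℂ :=
  (p 0 : ℂ) ^ 2 + (p 1 : ℂ) ^ 2 + (p 2 : ℂ) ^ 2 - ((t : ℂ) - Complex.I) ^ 2

theorem hopfDen_re (t : ℝ) (p : Fin 3 → ℝ) :
    (hopfDen t p).re = p 0 ^ 2 + p 1 ^ 2 + p 2 ^ 2 - t ^ 2 + 1 := by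
  simp only [hopfDen, sq, Complex.sub_re, Complex.sub_im, Complex.add_re, Complex.mul_re,
    Complex.ofReal_re, Complex.ofReal_im, Complex.I_re, Complex.I_im]
  ring

theorem hopfDen_im (t : ℝ) (p : Fin 3 → ℝ) : (hopfDen t p).im = 2 * t := by
  simp only [hopfDen, sq, Complex.sub_re, Complex.sub_im, Complex.add_im, Complex.mul_im,
    Complex.ofReal_re, Complex.ofReal_im, Complex.I_re, Complex.I_im]
  ring

theorem hopfDen_ne_zero (t : ℝ) (p : Fin 3 → ℝ) : hopfDen t p ≠ 0 := by
  intro h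
  have hre := hopfDen_re t p
  have him := hopfDen_im t p
  simp only [h, Complex.zero_re, Complex.zero_im] at hre him
  obtain rfl : t = 0 := by linarith
  nlinarith [sq_nonneg (p 0), sq_nonneg (p 1), sq_nonneg (p 2)]

theorem one_sub_hopfα_mul_hopfDen (t : ℝ) (p : Fin 3 → ℝ) :
    (1 - hopfα t p) * hopfDen t p = 2 * (1 + Complex.I * (t - p 2)) := by
  have hα : hopfα t p * hopfDen t p = _ := div_mul_cancel₀ _ (hopfDen_ne_zero t p)
  rw [sub_mul, hα, hopfDen]
  linear_combination -Complex.I_sq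

theorem hopfβ_mul_hopfDen (t : ℝ) (p : Fin 3 → ℝ) :
    hopfβ t p * hopfDen t p = 2 * (p 0 - Complex.I * p 1) :=
  div_mul_cancel₀ _ (hopfDen_ne_zero t p)

theorem one_sub_hopfα_mul (t : ℝ) (p : Fin 3 → ℝ) :
    (1 - hopfα t p) * (p 0 - Complex.I * p 1) = hopfβ t p * (1 + Complex.I * (t - p 2)) := by
  refine mul_right_cancel₀ (hopfDen_ne_zero t p) ?_
  linear_combination (p 0 - Complex.I * p 1) * one_sub_hopfα_mul_hopfDen t p -
    (1 + Complex.I * (t - p 2)) * hopfβ_mul_hopfDen t p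

theorem one_sub_hopfα_mul_add_hopfβ_mul (t : ℝ) (p : Fin 3 → ℝ) :
    (1 - hopfα t p) * (1 + Complex.I * (t + p 2)) + hopfβ t p * (p 0 + Complex.I * p 1) = 2 := by
  refine mul_right_cancel₀ (hopfDen_ne_zero t p) ?_
  have hD : hopfDen t p = p 0 ^ 2 + p 1 ^ 2 + p 2 ^ 2 - (t - Complex.I) ^ 2 := rfl
  linear_combination (1 + Complex.I * (t + p 2)) * one_sub_hopfα_mul_hopfDen t p +
    (p 0 + Complex.I * p 1) * hopfβ_mul_hopfDen t p - 2 * hD +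
    2 * (t ^ 2 - p 1 ^ 2 - p 2 ^ 2 + 1) * Complex.I_sq

@[fun_prop]
theorem contDiff_ofReal {n : WithTop ℕ∞} : ContDiff ℝ n fun x : ℝ => (x : ℂ) :=
  Complex.ofRealCLM.contDiff

theorem contDiff_hopfDen : ContDiff ℝ ∞ (Function.uncurry hopfDen) := by
  unfold Function.uncurry hopfDen
  fun_prop

theorem contDiff_hopfα : ContDiff ℝ ∞ (Function.uncurry hopfα) := by
  have hnum : ContDiff ℝ ∞ fun q : ℝ × (Fin 3 → ℝ) => (q.2 0 : ℂ) ^ 2 + (q.2 1 : ℂ) ^ 2 +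
      (q.2 2 : ℂ) ^ 2 - (q.1 : ℂ) ^ 2 - 1 + 2 * Complex.I * (q.2 2 : ℂ) := by fun_prop
  simpa only [div_eq_mul_inv] using!
    hnum.mul (contDiff_hopfDen.inv fun q => hopfDen_ne_zero q.1 q.2)

theorem contDiff_hopfβ : ContDiff ℝ ∞ (Function.uncurry hopfβ) := by
  have hnum : ContDiff ℝ ∞ fun q : ℝ × (Fin 3 → ℝ) =>
      2 * ((q.2 0 : ℂ) - Complex.I * (q.2 1 : ℂ)) := by fun_prop
  simpa only [div_eq_mul_inv] using!
    hnum.mul (contDiff_hopfDen.inv fun q => hopfDen_ne_zero q.1 q.2)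

theorem differentiable_hopfα (t : ℝ) : Differentiable ℝ (hopfα t) :=
  (contDiff_hopfα.comp (contDiff_prodMk_right t)).differentiable (by simp)

theorem differentiable_hopfβ (t : ℝ) : Differentiable ℝ (hopfβ t) :=
  (contDiff_hopfβ.comp (contDiff_prodMk_right t)).differentiable (by simp)

section AlongCurve

variable {τ : ℝ → ℝ} {c : ℝ → Fin 3 → ℝ} {s τ' : ℝ} {v : Fin 3 → ℝ}

theorem hasDerivAt_hopfDen_comp (hτ : HasDerivAt τ τ' s) (hc : HasDerivAt c v s) :
    HasDerivAt (fun s => hopfDen (τ s) (c s))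
      (2 * (c s 0 * v 0 + c s 1 * v 1 + c s 2 * v 2 - (τ s - Complex.I) * τ')) s := by
  have hcoord (i : Fin 3) := (hasDerivAt_pi.1 hc i).ofReal_comp
  refine (((((hcoord 0).pow 2).add ((hcoord 1).pow 2)).add ((hcoord 2).pow 2)).sub
    ((hτ.ofReal_comp.sub_const Complex.I).pow 2)).congr_deriv ?_
  push_cast
  ring

theorem hasDerivAt_hopfα_comp (hτ : HasDerivAt τ τ' s) (hc : HasDerivAt c v s) :
    HasDerivAt (fun s => hopfα (τ s) (c s)) (2 / hopfDen (τ s) (c s) *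
      ((1 - hopfα (τ s) (c s)) *
        (c s 0 * v 0 + c s 1 * v 1 + c s 2 * v 2 - (τ s - Complex.I) * τ') +
        Complex.I * (v 2 - τ'))) s := by
  have hD := hopfDen_ne_zero (τ s) (c s)
  have hα : (fun s => hopfα (τ s) (c s)) =
      fun s => 1 - 2 * (1 + Complex.I * (τ s - c s 2)) / hopfDen (τ s) (c s) := by
    funext s
    rw [← one_sub_hopfα_mul_hopfDen, mul_div_cancel_right₀ _ (hopfDen_ne_zero _ _), sub_sub_cancel]
  rw [hα]
  refine ((((((hτ.ofReal_comp.sub (hasDerivAt_pi.1 hc 2).ofReal_comp).const_mul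
    Complex.I).const_add 1).const_mul 2).div (hasDerivAt_hopfDen_comp hτ hc) hD).const_sub
      1).congr_deriv ?_
  simp only [Pi.sub_apply]
  field_simp
  linear_combination -(c s 0 * v 0 + c s 1 * v 1 + c s 2 * v 2 - (τ s - Complex.I) * τ') *
    one_sub_hopfα_mul_hopfDen (τ s) (c s)

theorem hasDerivAt_hopfβ_comp (hτ : HasDerivAt τ τ' s) (hc : HasDerivAt c v s) :
    HasDerivAt (fun s => hopfβ (τ s) (c s)) (2 / hopfDen (τ s) (c s) *
      (v 0 - Complex.I * v 1 - hopfβ (τ s) (c s) *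
        (c s 0 * v 0 + c s 1 * v 1 + c s 2 * v 2 - (τ s - Complex.I) * τ'))) s := by
  have hD := hopfDen_ne_zero (τ s) (c s)
  have hcoord (i : Fin 3) := (hasDerivAt_pi.1 hc i).ofReal_comp
  refine ((((hcoord 0).sub ((hcoord 1).const_mul Complex.I)).const_mul 2).div
    (hasDerivAt_hopfDen_comp hτ hc) hD).congr_deriv ?_
  simp only [Pi.sub_apply]
  field_simp
  linear_combination (c s 0 * v 0 + c s 1 * v 1 + c s 2 * v 2 - (τ s - Complex.I) * τ') *
    hopfβ_mul_hopfDen (τ s) (c s)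

end AlongCurve

theorem fderiv_eq_of_hasDerivAt_line {E F : Type*} [NormedAddCommGroup E] [NormedSpace ℝ E]
    [NormedAddCommGroup F] [NormedSpace ℝ F] {f : E → F} {p v : E} {f' : F}
    (hf : DifferentiableAt ℝ f p) (h : HasDerivAt (fun s : ℝ => f (p + s • v)) f' 0) :
    fderiv ℝ f p v = f' := by
  rw [← hf.lineDeriv_eq_fderiv]
  exact HasLineDerivAt.lineDeriv h

theorem hasDerivAt_line {E : Type*} [NormedAddCommGroup E] [NormedSpace ℝ E] (p v : E) (s : ℝ) :
    HasDerivAt (fun s : ℝ => p + s • v) v s := by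
  simpa using ((hasDerivAt_id s).smul_const v).const_add p

theorem grad_hopfα (t : ℝ) (p : Fin 3 → ℝ) :
    grad (hopfα t) p = (2 / hopfDen t p) • ![(1 - hopfα t p) * p 0, (1 - hopfα t p) * p 1,
      (1 - hopfα t p) * p 2 + Complex.I] := by
  funext i
  rw [grad, fderiv_eq_of_hasDerivAt_line (differentiable_hopfα t p)
    (hasDerivAt_hopfα_comp (hasDerivAt_const _ t) (hasDerivAt_line p _ 0))]
  fin_cases i <;> simp

theorem grad_hopfβ (t : ℝ) (p : Fin 3 → ℝ) :
    grad (hopfβ t) p = (2 / hopfDen t p) • ![1 - hopfβ t p * p 0,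
      -Complex.I - hopfβ t p * p 1, -(hopfβ t p * p 2)] := by
  funext i
  rw [grad, fderiv_eq_of_hasDerivAt_line (differentiable_hopfβ t p)
    (hasDerivAt_hopfβ_comp (hasDerivAt_const _ t) (hasDerivAt_line p _ 0))]
  fin_cases i <;> simp

theorem deriv_hopfα_time (t : ℝ) (p : Fin 3 → ℝ) :
    deriv (fun s => hopfα s p) t =
      2 / hopfDen t p * (-((1 - hopfα t p) * (t - Complex.I)) - Complex.I) := by
  refine (hasDerivAt_hopfα_comp (hasDerivAt_id' t) (hasDerivAt_const t p)).deriv.trans ?_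
  simp only [Pi.zero_apply, Complex.ofReal_zero, Complex.ofReal_one]
  ring

theorem deriv_hopfβ_time (t : ℝ) (p : Fin 3 → ℝ) :
    deriv (fun s => hopfβ s p) t = 2 / hopfDen t p * (hopfβ t p * (t - Complex.I)) := by
  refine (hasDerivAt_hopfβ_comp (hasDerivAt_id' t) (hasDerivAt_const t p)).deriv.trans ?_
  simp only [Pi.zero_apply, Complex.ofReal_zero, Complex.ofReal_one]
  ring

theorem grad_hopfα_cross_grad_hopfβ (t : ℝ) (p : Fin 3 → ℝ) :
    grad (hopfα t) p ⨯₃ grad (hopfβ t) p = (2 / hopfDen t p) ^ 2 •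
      ![Complex.I * (1 - hopfα t p) * p 2 - 1 + Complex.I * hopfβ t p * p 1,
        (1 - hopfα t p) * p 2 + Complex.I - Complex.I * hopfβ t p * p 0,
        -(Complex.I * (1 - hopfα t p) * (p 0 - Complex.I * p 1))] := by
  rw [grad_hopfα, grad_hopfβ, LinearMap.map_smul₂, map_smul, smul_smul, ← sq, cross_apply]
  congr 1
  funext i
  fin_cases i <;> simp only [Fin.zero_eta, Fin.mk_one, Fin.reduceFinMk, Matrix.cons_val]
  · linear_combination Complex.I_sq
  · ring
  · linear_combination -((1 - hopfα t p) * p 1) * Complex.I_sq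

theorem isBatemanPair_hopf : IsBatemanPair hopfα hopfβ := by
  refine ⟨contDiff_hopfα, contDiff_hopfβ, fun t p => ?_⟩
  rw [grad_hopfα_cross_grad_hopfβ, grad_hopfα, grad_hopfβ, deriv_hopfα_time, deriv_hopfβ_time]
  have hα := one_sub_hopfα_mul t p
  have hsum := one_sub_hopfα_mul_add_hopfβ_mul t p
  funext i
  fin_cases i <;> simp only [Fin.zero_eta, Fin.mk_one, Fin.reduceFinMk, Pi.smul_apply,
    Pi.sub_apply, smul_eq_mul, Matrix.cons_val]
  · linear_combination (2 / hopfDen t p) ^ 2 *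
      (hsum + (hopfα t p - hopfβ t p * p 0) * Complex.I_sq)
  · linear_combination (2 / hopfDen t p) ^ 2 *
      (((1 - hopfα t p) * p 2 - hopfα t p * Complex.I) * Complex.I_sq - Complex.I * hsum)
  · linear_combination -(2 / hopfDen t p) ^ 2 * Complex.I * (hα + hopfβ t p * Complex.I_sq)

/-! ## Pushing Hopf-type fields forward to the sphere -/

theorem one_sub_re_hopfα_mul_hopfDen_re (t : ℝ) (p : Fin 3 → ℝ) :
    (1 - (hopfα t p).re) * (hopfDen t p).re = 2 - 2 * t * (hopfα t p).im := by
  have h := congrArg Complex.re (one_sub_hopfα_mul_hopfDen t p)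
  simp only [Complex.mul_re, Complex.sub_re, Complex.sub_im, Complex.one_re, Complex.one_im,
    Complex.add_re, Complex.add_im, Complex.mul_im, Complex.I_re, Complex.I_im, Complex.ofReal_re,
    Complex.ofReal_im, Complex.re_ofNat, Complex.im_ofNat, hopfDen_im] at h
  linarith

theorem one_sub_re_hopfα_mul_normSq_hopfDen (t : ℝ) (p : Fin 3 → ℝ) :
    (1 - (hopfα t p).re) * Complex.normSq (hopfDen t p) =
      2 * (p 0 ^ 2 + p 1 ^ 2 + (p 2 - t) ^ 2 + 1) := by
  have hre := one_sub_re_hopfα_mul_hopfDen_re t p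
  have him := congrArg Complex.im (one_sub_hopfα_mul_hopfDen t p)
  simp only [Complex.mul_re, Complex.sub_re, Complex.sub_im, Complex.one_re, Complex.one_im,
    Complex.add_re, Complex.add_im, Complex.mul_im, Complex.I_re, Complex.I_im, Complex.ofReal_re,
    Complex.ofReal_im, Complex.re_ofNat, Complex.im_ofNat, hopfDen_im] at him
  rw [Complex.normSq_apply, hopfDen_im]
  linear_combination (hopfDen t p).re * hre + 2 * t * him + 2 * hopfDen_re t p

theorem re_hopfα_lt_one (t : ℝ) (p : Fin 3 → ℝ) : (hopfα t p).re < 1 := by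
  have h := one_sub_re_hopfα_mul_normSq_hopfDen t p
  have hpos : 0 < (1 - (hopfα t p).re) * Complex.normSq (hopfDen t p) := by
    rw [h]
    positivity
  linarith [pos_of_mul_pos_left hpos (Complex.normSq_nonneg _)]

/-- The factor by which the differential of `(α, β)` at time `t` stretches `∇α × ∇β`, relative to
the frame field `v₁` of the sphere. -/
noncomputable def hopfFactor (t : ℝ) (p : Fin 3 → ℝ) : ℝ :=
  4 * (1 - (hopfα t p).re) / Complex.normSq (hopfDen t p)

theorem hopfFactor_pos (t : ℝ) (p : Fin 3 → ℝ) : 0 < hopfFactor t p :=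
  div_pos (mul_pos four_pos (sub_pos.2 (re_hopfα_lt_one t p)))
    (Complex.normSq_pos.2 (hopfDen_ne_zero t p))

theorem continuous_hopfFactor (t : ℝ) : Continuous (hopfFactor t) := by
  have hD : Continuous (hopfDen t) := by
    unfold hopfDen
    fun_prop
  have hα : Continuous (hopfα t) := (differentiable_hopfα t).continuous
  refine Continuous.div (by fun_prop) ?_ fun p => Complex.normSq_eq_zero.not.2 (hopfDen_ne_zero t p)
  exact Complex.continuous_normSq.comp hD

theorem ofReal_hopfFactor (t : ℝ) (p : Fin 3 → ℝ) :
    (hopfFactor t p : ℂ) = 2 * (1 - hopfα t p + star (1 - hopfα t p)) /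
      (hopfDen t p * star (hopfDen t p)) := by
  have hre : 1 - hopfα t p + star (1 - hopfα t p) = ((2 * (1 - (hopfα t p).re) : ℝ) : ℂ) :=
    Complex.add_conj _
  have hnorm : hopfDen t p * star (hopfDen t p) = (Complex.normSq (hopfDen t p) : ℂ) :=
    Complex.mul_conj _
  rw [hre, hnorm, hopfFactor]
  push_cast
  ring

theorem star_hopfDen (t : ℝ) (p : Fin 3 → ℝ) :
    star (hopfDen t p) = hopfDen t p - 4 * t * Complex.I := by
  have h : hopfDen t p - star (hopfDen t p) = ((2 * (hopfDen t p).im : ℝ) : ℂ) * Complex.I :=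
    Complex.sub_conj _
  rw [hopfDen_im] at h
  push_cast at h
  linear_combination -h

theorem star_grad_cross_grad (t : ℝ) (p : Fin 3 → ℝ) :
    star (grad (hopfα t) p ⨯₃ grad (hopfβ t) p) = (2 / star (hopfDen t p)) ^ 2 •
      ![-(Complex.I * star (1 - hopfα t p) * p 2) - 1 - Complex.I * star (hopfβ t p) * p 1,
        star (1 - hopfα t p) * p 2 - Complex.I + Complex.I * star (hopfβ t p) * p 0,
        Complex.I * star (1 - hopfα t p) * (p 0 + Complex.I * p 1)] := by
  rw [grad_hopfα_cross_grad_hopfβ, star_smul]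
  congr 1
  · simp
  · funext i
    fin_cases i <;> simp <;> ring

theorem grad_hopfα_dotProduct_star_cross (t : ℝ) (p : Fin 3 → ℝ) :
    grad (hopfα t) p ⬝ᵥ star (grad (hopfα t) p ⨯₃ grad (hopfβ t) p) =
      -(2 * hopfFactor t p * star (hopfβ t p)) := by
  have hD := hopfDen_ne_zero t p
  have hD' := star_ne_zero.2 hD
  have hβ : star (hopfβ t p) * star (hopfDen t p) = 2 * (p 0 + Complex.I * p 1) := by
    simpa using! congrArg star (hopfβ_mul_hopfDen t p)
  rw [star_grad_cross_grad, grad_hopfα, smul_dotProduct, dotProduct_smul, vec3_dotProduct',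
    ofReal_hopfFactor]
  simp only [smul_eq_mul]
  generalize star (1 - hopfα t p) = A at *
  field_simp
  linear_combination (1 - hopfα t p + A) * hβ +
    2 * A * ((1 - hopfα t p) * p 2 * p 1 + p 0 + Complex.I * p 1) * Complex.I_sq

theorem grad_hopfβ_dotProduct_star_cross (t : ℝ) (p : Fin 3 → ℝ) :
    grad (hopfβ t) p ⬝ᵥ star (grad (hopfα t) p ⨯₃ grad (hopfβ t) p) =
      2 * hopfFactor t p * star (hopfα t p) := by
  have hD := hopfDen_ne_zero t p
  have hD' := star_ne_zero.2 hD
  have hα := one_sub_hopfα_mul_hopfDen t p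
  have hα' : star (1 - hopfα t p) * star (hopfDen t p) = 2 * (1 - Complex.I * (t - p 2)) := by
    simpa [sub_eq_add_neg] using! congrArg star hα
  have hsum := one_sub_hopfα_mul_add_hopfβ_mul t p
  have hsum' : star (1 - hopfα t p) * (1 - Complex.I * (t + p 2)) +
      star (hopfβ t p) * (p 0 - Complex.I * p 1) = 2 := by
    simpa [sub_eq_add_neg] using! congrArg star hsum
  have hone : star (hopfα t p) = 1 - star (1 - hopfα t p) := by simp
  rw [star_grad_cross_grad, grad_hopfβ, smul_dotProduct, dotProduct_smul, vec3_dotProduct',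
    ofReal_hopfFactor, hone]
  simp only [smul_eq_mul]
  generalize star (1 - hopfα t p) = A at *
  field_simp
  linear_combination 2 * hsum + 2 * hsum' - (hα + (1 - hopfα t p) * star_hopfDen t p) +
    (1 - hopfα t p + A - 1) * hα' +
    2 * (1 - hopfβ t p * A * p 2 * p 1 - p 0 * star (hopfβ t p)) * Complex.I_sq

/-- The factor by which a field has to be multiplied such that the chosen part becomes its real
part. -/
noncomputable def FieldPart.phase : FieldPart → ℂ
  | .electric => 1
  | .magnetic => -Complex.I

theorem FieldPart.of_apply (part : FieldPart) (F : ℝ → (Fin 3 → ℝ) → Fin 3 → ℂ) (t : ℝ)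
    (p : Fin 3 → ℝ) (i : Fin 3) : part.of F t p i = ((part.phase • F t p) i).re := by
  cases part <;> simp [FieldPart.of, FieldPart.phase]

theorem fderiv_apply_eq_grad_dotProduct (f : (Fin 3 → ℝ) → ℂ) (p v : Fin 3 → ℝ) :
    fderiv ℝ f p v = grad f p ⬝ᵥ fun i => (v i : ℂ) := by
  conv_lhs => rw [pi_eq_sum_univ' v, map_sum]
  refine Finset.sum_congr rfl fun i _ => ?_
  rw [map_smul, grad, Complex.real_smul, mul_comm]

theorem dotProduct_ofReal_re {ι : Type*} [Fintype ι] (g w : ι → ℂ) :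
    (g ⬝ᵥ fun i => ((w i).re : ℂ)) = (g ⬝ᵥ w + g ⬝ᵥ star w) / 2 := by
  rw [← dotProduct_add, div_eq_mul_inv, dotProduct, dotProduct, Finset.sum_mul]
  refine Finset.sum_congr rfl fun i _ => ?_
  rw [Complex.re_eq_add_conj, Pi.add_apply, Pi.star_apply, Complex.star_def]
  ring

theorem fderiv_apply_re (f : (Fin 3 → ℝ) → ℂ) (p : Fin 3 → ℝ) (w : ℂ) {C : Fin 3 → ℂ}
    (hC : grad f p ⬝ᵥ C = 0) :
    fderiv ℝ f p (fun i => ((w • C) i).re) = star w * (grad f p ⬝ᵥ star C) / 2 := by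
  rw [fderiv_apply_eq_grad_dotProduct, dotProduct_ofReal_re, star_smul, dotProduct_smul,
    dotProduct_smul, hC, smul_zero, zero_add, smul_eq_mul]

/-- The vector field on the sphere onto which `(α, β)` maps the chosen part of the field
`h(α, β) ∇α × ∇β`, up to a positive factor. -/
noncomputable def sphereField (part : FieldPart) (h : ℂ × ℂ → ℂ) (z : ℂ × ℂ) : ℂ × ℂ :=
  star (part.phase * h z) • v₁ z

theorem v₁_eq (z : ℂ × ℂ) : v₁ z = (-star z.2, star z.1) := by
  refine Prod.ext ?_ ?_ <;> apply Complex.ext <;> simp [v₁]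

theorem hasFDerivAt_hopfMap (t : ℝ) (p : Fin 3 → ℝ) :
    HasFDerivAt (hopfMap t) ((fderiv ℝ (hopfα t) p).prod (fderiv ℝ (hopfβ t) p)) p :=
  (differentiable_hopfα t p).hasFDerivAt.prodMk (differentiable_hopfβ t p).hasFDerivAt

theorem fderiv_hopfMap_batemanField (part : FieldPart) (h : ℂ × ℂ → ℂ) (t : ℝ) (p : Fin 3 → ℝ) :
    fderiv ℝ (hopfMap t) p (part.of (batemanField hopfα hopfβ h) t p) =
      hopfFactor t p • sphereField part h (hopfMap t p) := by
  have hV : part.of (batemanField hopfα hopfβ h) t p = fun i =>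
      (((part.phase * h (hopfMap t p)) • (grad (hopfα t) p ⨯₃ grad (hopfβ t) p)) i).re := by
    funext i
    rw [FieldPart.of_apply, batemanField, smul_smul, hopfMap]
  rw [(hasFDerivAt_hopfMap t p).fderiv, ContinuousLinearMap.prod_apply, hV,
    fderiv_apply_re _ _ _ (dot_self_cross _ _), fderiv_apply_re _ _ _ (dot_cross_self _ _),
    grad_hopfα_dotProduct_star_cross, grad_hopfβ_dotProduct_star_cross, sphereField, v₁_eq]
  ext1
  · simp only [hopfMap, Prod.smul_fst, Complex.real_smul, smul_eq_mul]
    ring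
  · simp only [hopfMap, Prod.smul_snd, Complex.real_smul, smul_eq_mul]
    ring

/-! ## The inverse of the map to the sphere -/

/-- The common denominator of the Hopf pair at the preimage of `z` under `(α, β)` at time `t`, for
`z` on the sphere other than `(1, 0)`. -/
noncomputable def hopfInvDen (t : ℝ) (z : ℂ × ℂ) : ℂ :=
  ⟨(2 - 2 * t * z.1.im) / (1 - z.1.re), 2 * t⟩

/-- The inverse of `(α, β)` at time `t` on the sphere without `(1, 0)`, obtained by solving
`(1 - α) D = 2 (1 + i (t - z))` and `β D = 2 (x - i y)` for the point, where `D` is the common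
denominator. -/
noncomputable def hopfInv (t : ℝ) (z : ℂ × ℂ) : Fin 3 → ℝ :=
  ![(z.2 * hopfInvDen t z / 2).re, -(z.2 * hopfInvDen t z / 2).im,
    t - ((1 - z.1) * hopfInvDen t z / 2).im]

theorem hopfInvDen_hopfMap (t : ℝ) (p : Fin 3 → ℝ) : hopfInvDen t (hopfMap t p) = hopfDen t p := by
  refine Complex.ext ?_ (hopfDen_im t p).symm
  exact ((eq_div_iff (sub_pos.2 (re_hopfα_lt_one t p)).ne').2
    ((mul_comm _ _).trans (one_sub_re_hopfα_mul_hopfDen_re t p))).symm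

theorem hopfInv_hopfMap (t : ℝ) (p : Fin 3 → ℝ) : hopfInv t (hopfMap t p) = p := by
  have hα := one_sub_hopfα_mul_hopfDen t p
  have hβ := hopfβ_mul_hopfDen t p
  rw [hopfInv, hopfInvDen_hopfMap, hopfMap, hα, hβ]
  funext i
  fin_cases i <;> simp

theorem one_sub_mul_hopfInvDen (t : ℝ) {z : ℂ × ℂ} (h1 : z.1.re ≠ 1) :
    (1 - z.1) * hopfInvDen t z = 2 * (1 + Complex.I * (t - hopfInv t z 2)) := by
  have h : 1 - z.1.re ≠ 0 := sub_ne_zero.2 h1.symm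
  apply Complex.ext
  · simp only [hopfInvDen, Complex.mul_re, Complex.mul_im, Complex.sub_re, Complex.sub_im,
      Complex.add_re, Complex.add_im, Complex.one_re, Complex.one_im, Complex.I_re, Complex.I_im,
      Complex.ofReal_re, Complex.ofReal_im, Complex.re_ofNat, Complex.im_ofNat]
    field_simp
    ring
  · simp [hopfInv]
    ring

theorem mul_hopfInvDen (t : ℝ) (z : ℂ × ℂ) :
    z.2 * hopfInvDen t z = 2 * (hopfInv t z 0 - Complex.I * hopfInv t z 1) := by
  apply Complex.ext <;> simp [hopfInv] <;> ring

theorem hopfDen_hopfInv (t : ℝ) {z : ℂ × ℂ}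
    (hz : Complex.normSq z.1 + Complex.normSq z.2 = 1) (h1 : z.1.re ≠ 1) :
    hopfDen t (hopfInv t z) = hopfInvDen t z := by
  refine Complex.ext ?_ (hopfDen_im t _)
  have him : (hopfInvDen t z).im = 2 * t := rfl
  have hα := one_sub_mul_hopfInvDen t h1
  have hαre := congrArg Complex.re hα
  have hαim := congrArg Complex.im hα
  have hαnorm := congrArg Complex.normSq hα
  have hβnorm := congrArg Complex.normSq (mul_hopfInvDen t z)
  rw [Complex.normSq_mul] at hαnorm hβnorm
  rw [hopfDen_re]
  simp only [Complex.normSq_apply, Complex.mul_re, Complex.mul_im, Complex.sub_re, Complex.sub_im,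
    Complex.add_re, Complex.add_im, Complex.one_re, Complex.one_im, Complex.I_re, Complex.I_im,
    Complex.ofReal_re, Complex.ofReal_im, Complex.re_ofNat, Complex.im_ofNat, him]
    at hz hαre hαim hαnorm hβnorm
  generalize (hopfInvDen t z).re = A at *
  generalize hopfInv t z 0 = x at *
  generalize hopfInv t z 1 = y at *
  generalize hopfInv t z 2 = w at *
  linear_combination -hαnorm / 4 - hβnorm / 4 + (A ^ 2 + 4 * t ^ 2) / 4 * hz + A / 2 * hαre +
    t * hαim

theorem hopfMap_hopfInv (t : ℝ) {z : ℂ × ℂ}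
    (hz : Complex.normSq z.1 + Complex.normSq z.2 = 1) (h1 : z.1.re ≠ 1) :
    hopfMap t (hopfInv t z) = z := by
  have hα := one_sub_hopfα_mul_hopfDen t (hopfInv t z)
  have hβ := hopfβ_mul_hopfDen t (hopfInv t z)
  have hD := hopfDen_ne_zero t (hopfInv t z)
  rw [← one_sub_mul_hopfInvDen t h1, ← hopfDen_hopfInv t hz h1] at hα
  rw [← mul_hopfInvDen, ← hopfDen_hopfInv t hz h1] at hβ
  exact Prod.ext (sub_right_injective (mul_right_cancel₀ hD hα)) (mul_right_cancel₀ hD hβ)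

theorem differentiableAt_hopfInv (t : ℝ) {z : ℂ × ℂ} (hz : z.1.re ≠ 1) :
    DifferentiableAt ℝ (hopfInv t) z := by
  have h : 1 - z.1.re ≠ 0 := sub_ne_zero.2 hz.symm
  have hden : DifferentiableAt ℝ (hopfInvDen t) z := by
    have hmk : hopfInvDen t = fun z : ℂ × ℂ =>
        (((2 - 2 * t * z.1.im) / (1 - z.1.re) : ℝ) : ℂ) + (2 * t : ℝ) * Complex.I :=
      funext fun _ => Complex.mk_eq_add_mul_I _ _
    rw [hmk]
    fun_prop (disch := exact h)
  rw [differentiableAt_pi]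
  intro i
  fin_cases i <;> simp only [hopfInv, Fin.zero_eta, Fin.mk_one, Fin.reduceFinMk,
    Matrix.cons_val] <;> fun_prop

/-! ## Closed field lines -/

theorem exists_orderIso_hasDerivAt {g : ℝ → ℝ} {T : ℝ} (hg : Continuous g) (hpos : ∀ s, 0 < g s)
    (hT : 0 < T) (hgT : Function.Periodic g T) :
    ∃ e : ℝ ≃o ℝ, e 0 = 0 ∧ (∀ s, e (s + T) = e s + e T) ∧ ∀ s, HasDerivAt e (g s) s := by
  set τ : ℝ → ℝ := fun s => ∫ x in (0 : ℝ)..s, g x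
  have hderiv (s : ℝ) : HasDerivAt τ (g s) s := (hg.integral_hasStrictDerivAt 0 s).hasDerivAt
  have hmono : StrictMono τ := strictMono_of_hasDerivAt_pos hderiv hpos
  have hzero : τ 0 = 0 := intervalIntegral.integral_same
  have hTpos : 0 < τ T := hzero ▸ hmono hT
  have hsurj : Function.Surjective τ :=
    (intervalIntegral.continuous_primitive (fun a b => hg.intervalIntegrable a b) 0).surjective
      (hgT.tendsto_atTop_intervalIntegral_of_pos hTpos hT)
      (hgT.tendsto_atBot_intervalIntegral_of_pos hTpos hT)
  refine ⟨hmono.orderIsoOfSurjective τ hsurj, hzero, fun s => ?_, hderiv⟩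
  have hadd := hgT.intervalIntegral_add_eq_add 0 s fun a b => hg.intervalIntegrable a b
  rwa [zero_add] at hadd

theorem hasDerivAt_comp_symm {E : Type*} [NormedAddCommGroup E] [NormedSpace ℝ E] {V : E → E}
    {c : ℝ → E} {g : ℝ → ℝ} (hpos : ∀ s, 0 < g s) {e : ℝ ≃o ℝ} (he : ∀ s, HasDerivAt e (g s) s)
    (hc : ∀ s, HasDerivAt c (g s • V (c s)) s) (s : ℝ) :
    HasDerivAt (c ∘ e.symm) (V (c (e.symm s))) s := by
  have hsymm : HasDerivAt e.symm (g (e.symm s))⁻¹ s :=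
    (he _).of_local_left_inverse e.symm.continuous.continuousAt (hpos _).ne'
      (Filter.Eventually.of_forall e.apply_symm_apply)
  refine ((hc (e.symm s)).scomp s hsymm).congr_deriv ?_
  rw [smul_smul, inv_mul_cancel₀ (hpos _).ne', one_smul]

theorem isClosedFieldLine_of_reparam {E : Type*} [NormedAddCommGroup E] [NormedSpace ℝ E]
    {V : E → E} {T : ℝ} {c : ℝ → E} {g : ℝ → ℝ} (hg : Continuous g) (hpos : ∀ s, 0 < g s)
    (hT : 0 < T) (hgT : Function.Periodic g T) (hc : ∀ s, HasDerivAt c (g s • V (c s)) s)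
    (hcT : Function.Periodic c T) (hinj : InjOn c (Ico 0 T)) :
    IsClosedFieldLine V (range c) := by
  obtain ⟨e, he0, hadd, he⟩ := exists_orderIso_hasDerivAt hg hpos hT hgT
  have hsymm (s : ℝ) : e.symm (s + e T) = e.symm s + T := by
    rw [e.symm_apply_eq, hadd, e.apply_symm_apply]
  refine ⟨e T, c ∘ e.symm, ?_, hasDerivAt_comp_symm hpos he hc, fun s => ?_, ?_, ?_⟩
  · simpa only [he0] using e.strictMono hT
  · rw [Function.comp_apply, hsymm, hcT, Function.comp_apply]
  · refine hinj.comp e.symm.injective.injOn fun s hs => ⟨?_, ?_⟩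
    · rw [← e.symm_apply_apply 0, he0]
      exact e.symm.monotone hs.1
    · rw [← e.symm_apply_apply T]
      exact e.symm.strictMono hs.2
  · exact e.symm.surjective.range_comp c

theorem fderiv_fderiv_apply_of_leftInverse {E F : Type*} [NormedAddCommGroup E] [NormedSpace ℝ E]
    [NormedAddCommGroup F] [NormedSpace ℝ F] {Φ : E → F} {Ψ : F → E} {p : E}
    (hΨΦ : Function.LeftInverse Ψ Φ) (hΦ : DifferentiableAt ℝ Φ p)
    (hΨ : DifferentiableAt ℝ Ψ (Φ p)) (v : E) : fderiv ℝ Ψ (Φ p) (fderiv ℝ Φ p v) = v := by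
  rw [← ContinuousLinearMap.comp_apply, ← fderiv_comp p hΨ hΦ, hΨΦ.comp_eq_id, fderiv_id,
    ContinuousLinearMap.id_apply]

theorem IsClosedFieldLine.preimage {E F : Type*} [NormedAddCommGroup E] [NormedSpace ℝ E]
    [NormedAddCommGroup F] [NormedSpace ℝ F] {V : E → E} {W : F → F} {C : Set F}
    (hC : IsClosedFieldLine W C) {Φ : E → F} {Ψ : F → E} {ρ : E → ℝ}
    (hΦ : Differentiable ℝ Φ) (hΨ : ∀ z ∈ C, DifferentiableAt ℝ Ψ z)
    (hΨΦ : Function.LeftInverse Ψ Φ) (hΦΨ : ∀ z ∈ C, Φ (Ψ z) = z) (hρ : Continuous ρ)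
    (hρpos : ∀ p, 0 < ρ p) (hV : ∀ p, fderiv ℝ Φ p (V p) = ρ p • W (Φ p)) :
    IsClosedFieldLine V (Φ ⁻¹' C) := by
  obtain ⟨T, c, hT, hc, hcT, hinj, rfl⟩ := hC
  have hΦc (s : ℝ) : Φ (Ψ (c s)) = c s := hΦΨ _ ⟨s, rfl⟩
  have hderiv (s : ℝ) : HasDerivAt (Ψ ∘ c) ((ρ (Ψ (c s)))⁻¹ • V (Ψ (c s))) s := by
    have hΨc : DifferentiableAt ℝ Ψ (c s) := hΨ _ ⟨s, rfl⟩
    refine (hΨc.hasFDerivAt.comp_hasDerivAt s (hc s)).congr_deriv ?_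
    have hVs := hV (Ψ (c s))
    rw [hΦc] at hVs
    rw [eq_inv_smul_iff₀ (hρpos _).ne', ← map_smul, ← hVs]
    simpa only [hΦc] using fderiv_fderiv_apply_of_leftInverse hΨΦ (hΦ (Ψ (c s)))
      ((hΦc s).symm ▸ hΨc) (V (Ψ (c s)))
  have hcont : Continuous (Ψ ∘ c) := continuous_iff_continuousAt.2 fun s => (hderiv s).continuousAt
  have hpre : Φ ⁻¹' range c = range (Ψ ∘ c) := by
    ext p
    refine ⟨fun ⟨s, hs⟩ => ⟨s, ?_⟩, ?_⟩
    · rw [Function.comp_apply, hs, hΨΦ]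
    · rintro ⟨s, rfl⟩
      exact ⟨s, (hΦc s).symm⟩
  rw [hpre]
  refine isClosedFieldLine_of_reparam ((hρ.comp hcont).inv₀ fun s => (hρpos _).ne')
    (fun s => inv_pos.2 (hρpos _)) hT (fun s => ?_) hderiv (hcT.comp Ψ) fun a ha b hb hab => ?_
  · exact congrArg (fun z => (ρ (Ψ z))⁻¹) (hcT s)
  · exact hinj ha hb (by rw [← hΦc a, ← hΦc b]; exact congrArg Φ hab)

/-! ## Legendrian curves on the sphere -/

/- For a curve `u` in `ℂ²`, the identity `r ^ 2 = |u| ^ 2` makes the real part of `hleg` automatic,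
while its imaginary part says that the projected curve is Legendrian. -/
theorem hasDerivAt_div_of_legendrian {u₁ u₂ : ℝ → ℂ} {r : ℝ → ℝ} {t r' : ℝ} {u₁' u₂' : ℂ}
    (hu₁ : HasDerivAt u₁ u₁' t) (hu₂ : HasDerivAt u₂ u₂' t) (hr : HasDerivAt r r' t)
    (hr₀ : r t ≠ 0) (hsq : (r t : ℂ) ^ 2 = star (u₁ t) * u₁ t + star (u₂ t) * u₂ t)
    (hleg : (r t : ℂ) * r' = star (u₁ t) * u₁' + star (u₂ t) * u₂') :
    HasDerivAt (fun s => (u₁ s / r s, u₂ s / r s))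
      (((u₁ t * u₂' - u₂ t * u₁') / (r t : ℂ) ^ 2) • v₁ (u₁ t / r t, u₂ t / r t)) t := by
  have hrt : (r t : ℂ) ≠ 0 := Complex.ofReal_ne_zero.2 hr₀
  have hstar : star (r t : ℂ) = r t := Complex.conj_ofReal _
  refine ((hu₁.div hr.ofReal_comp hrt).prodMk (hu₂.div hr.ofReal_comp hrt)).congr_deriv ?_
  rw [v₁_eq]
  ext1
  · simp only [Prod.smul_fst, smul_eq_mul, star_div₀, hstar]
    field_simp
    linear_combination u₁' * hsq - u₁ t * hleg
  · simp only [Prod.smul_snd, smul_eq_mul, star_div₀, hstar]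
    field_simp
    linear_combination u₂' * hsq - u₂ t * hleg

theorem realDot_smul_v₁_v₁ (c : ℂ) (z : ℂ × ℂ) :
    realDot (c • v₁ z) (v₁ z) = c.re * (Complex.normSq z.1 + Complex.normSq z.2) := by
  simp only [realDot, v₁, Prod.smul_fst, Prod.smul_snd, smul_eq_mul, Complex.mul_re,
    Complex.mul_im, Complex.normSq_apply]
  ring

theorem realDot_smul_v₁_v₂ (c : ℂ) (z : ℂ × ℂ) :
    realDot (c • v₁ z) (v₂ z) = c.im * (Complex.normSq z.1 + Complex.normSq z.2) := by
  simp only [realDot, v₁, v₂, Prod.smul_fst, Prod.smul_snd, smul_eq_mul, Complex.mul_re,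
    Complex.mul_im, Complex.normSq_apply]
  ring

theorem eq_one_zero_of_re_eq_one {z : ℂ × ℂ} (hz : Complex.normSq z.1 + Complex.normSq z.2 = 1)
    (hre : z.1.re = 1) : z = (1, 0) := by
  rw [Complex.normSq_apply z.1, hre] at hz
  have him : z.1.im = 0 := by nlinarith [Complex.normSq_nonneg z.2]
  have hz₂ : Complex.normSq z.2 = 0 := by
    rw [him] at hz
    linarith
  exact Prod.ext (Complex.ext hre him) (Complex.normSq_eq_zero.1 hz₂)

namespace FourierCurve

variable (K : FourierCurve)

/-- The first coordinate `1 + i Z` of the curve in `ℂ²` whose radial projection is `γ`. -/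
noncomputable def num₁ (t : ℝ) : ℂ := 1 + Complex.I * K.Z t

/-- The second coordinate `X + i Y` of the curve in `ℂ²` whose radial projection is `γ`. -/
noncomputable def num₂ (t : ℝ) : ℂ := K.X t + Complex.I * K.Y t

/-- The Wronskian `u₁ u₂' - u₂ u₁'` of the coordinates `u₁ = 1 + i Z`, `u₂ = X + i Y`. -/
noncomputable def numWronskian (t : ℝ) : ℂ := K.num₁ t * deriv K.num₂ t - K.num₂ t * deriv K.num₁ t

theorem R_pos (t : ℝ) : 0 < K.R t := Real.sqrt_pos.2 (by positivity)

theorem ofReal_R_ne_zero (t : ℝ) : (K.R t : ℂ) ≠ 0 := Complex.ofReal_ne_zero.2 (K.R_pos t).ne'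

theorem ofReal_R_sq (t : ℝ) :
    (K.R t : ℂ) ^ 2 = 1 + (K.X t : ℂ) ^ 2 + (K.Y t : ℂ) ^ 2 + (K.Z t : ℂ) ^ 2 := by
  have h : K.R t ^ 2 = 1 + K.X t ^ 2 + K.Y t ^ 2 + K.Z t ^ 2 := Real.sq_sqrt (by positivity)
  exact_mod_cast h

theorem γ_eq (t : ℝ) : K.γ t = (K.num₁ t / K.R t, K.num₂ t / K.R t) := by
  refine Prod.ext ?_ ?_ <;> apply Complex.ext <;>
    simp [γ, num₁, num₂, Complex.div_ofReal_re, Complex.div_ofReal_im]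

theorem star_num₁ (t : ℝ) : star (K.num₁ t) = 1 - Complex.I * K.Z t := by
  simp [num₁, sub_eq_add_neg]

theorem star_num₂ (t : ℝ) : star (K.num₂ t) = K.X t - Complex.I * K.Y t := by
  simp [num₂, sub_eq_add_neg]

theorem hasDerivAt_num₁ (t : ℝ) : HasDerivAt K.num₁ (Complex.I * (deriv K.Z t : ℝ)) t :=
  ((K.hasDerivAt_Z t).differentiableAt.hasDerivAt.ofReal_comp.const_mul Complex.I).const_add 1

theorem hasDerivAt_num₂ (t : ℝ) :
    HasDerivAt K.num₂ ((deriv K.X t : ℝ) + Complex.I * (deriv K.Y t : ℝ)) t :=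
  (K.hasDerivAt_X t).ofReal_comp.add ((K.hasDerivAt_Y t).ofReal_comp.const_mul Complex.I)

theorem hasDerivAt_R (t : ℝ) : HasDerivAt K.R
    ((K.X t * deriv K.X t + K.Y t * deriv K.Y t + K.Z t * deriv K.Z t) / K.R t) t := by
  have hZ := (K.hasDerivAt_Z t).differentiableAt.hasDerivAt
  have hq := (((((K.hasDerivAt_X t).fun_pow 2).const_add 1).fun_add
    ((K.hasDerivAt_Y t).fun_pow 2)).fun_add (hZ.fun_pow 2)).sqrt
      (show 1 + K.X t ^ 2 + K.Y t ^ 2 + K.Z t ^ 2 ≠ 0 by positivity)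
  refine hq.congr_deriv ?_
  have hR : √(1 + K.X t ^ 2 + K.Y t ^ 2 + K.Z t ^ 2) = K.R t := rfl
  have hR₀ := (K.R_pos t).ne'
  rw [hR]
  field_simp
  ring

theorem hasDerivAt_γ (t : ℝ) :
    HasDerivAt K.γ ((K.numWronskian t / (K.R t : ℂ) ^ 2) • v₁ (K.γ t)) t := by
  rw [numWronskian, (K.hasDerivAt_num₁ t).deriv, (K.hasDerivAt_num₂ t).deriv, K.γ_eq,
    show K.γ = _ from funext K.γ_eq]
  refine hasDerivAt_div_of_legendrian (K.hasDerivAt_num₁ t) (K.hasDerivAt_num₂ t)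
    (K.hasDerivAt_R t) (K.R_pos t).ne' ?_ ?_
  · rw [ofReal_R_sq, star_num₁, star_num₂, num₁, num₂]
    linear_combination ((K.Z t : ℂ) ^ 2 + (K.Y t : ℂ) ^ 2) * Complex.I_sq
  · have hR := K.ofReal_R_ne_zero t
    rw [star_num₁, star_num₂, (K.hasDerivAt_Z t).deriv]
    push_cast
    field_simp
    linear_combination (K.Z t * (K.Y t * deriv K.X t - K.X t * deriv K.Y t) +
      K.Y t * deriv K.Y t : ℂ) * Complex.I_sq

theorem normSq_γ (t : ℝ) : Complex.normSq (K.γ t).1 + Complex.normSq (K.γ t).2 = 1 := by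
  have hsq : K.R t ^ 2 = 1 + K.X t ^ 2 + K.Y t ^ 2 + K.Z t ^ 2 := Real.sq_sqrt (by positivity)
  have hR := (K.R_pos t).ne'
  simp only [γ, Complex.normSq_apply]
  field_simp
  linarith

variable {K}

theorem re_γ_ne_one (hK : ((1, 0) : ℂ × ℂ) ∉ K.image) (t : ℝ) : (K.γ t).1.re ≠ 1 :=
  fun h => hK ⟨t, eq_one_zero_of_re_eq_one (K.normSq_γ t) h⟩

end FourierCurve

theorem phase_mul_targetH (part : FieldPart) (K : FourierCurve) (t : ℝ) :
    part.phase * targetH part K t = star (K.numWronskian t) / (K.R t : ℂ) ^ 2 := by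
  have hstar : star (K.numWronskian t) / (K.R t : ℂ) ^ 2 =
      star (K.numWronskian t / (K.R t : ℂ) ^ 2) := by simp
  rw [hstar]
  cases part <;> apply Complex.ext <;> simp only [FieldPart.phase, targetH,
    (K.hasDerivAt_γ t).deriv, realDot_smul_v₁_v₁, realDot_smul_v₁_v₂, K.normSq_γ] <;>
    generalize K.numWronskian t / (K.R t : ℂ) ^ 2 = c <;> simp

theorem sphereField_γ {part : FieldPart} {K : FourierCurve} {h : ℂ × ℂ → ℂ} {t : ℝ}
    (ht : h (K.γ t) = targetH part K t) : sphereField part h (K.γ t) = deriv K.γ t := by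
  rw [sphereField, ht, phase_mul_targetH, (K.hasDerivAt_γ t).deriv]
  simp

theorem FieldPart.phase_ne_zero (part : FieldPart) : part.phase ≠ 0 := by
  cases part <;> simp [FieldPart.phase]

namespace FourierCurve

variable {K : FourierCurve}

theorem Balanced.num₁_mem_trigSpan (hK : K.Balanced) : K.num₁ ∈ trigSpan K.deg :=
  add_mem (const_mem_trigSpan 1 _)
    (Submodule.smul_mem _ Complex.I hK.isTrigPolynomial_deg.2.2.mem_trigSpan)

theorem Balanced.num₂_mem_trigSpan (hK : K.Balanced) : K.num₂ ∈ trigSpan K.deg :=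
  add_mem hK.isTrigPolynomial_deg.1.mem_trigSpan
    (Submodule.smul_mem _ Complex.I hK.isTrigPolynomial_deg.2.1.mem_trigSpan)

theorem Balanced.deriv_num₁_mem_trigSpan (hK : K.Balanced) : deriv K.num₁ ∈ trigSpan K.deg := by
  rw [funext fun t => (K.hasDerivAt_num₁ t).deriv]
  exact Submodule.smul_mem _ Complex.I hK.isTrigPolynomial_deg.2.2.deriv.mem_trigSpan

theorem Balanced.deriv_num₂_mem_trigSpan (hK : K.Balanced) : deriv K.num₂ ∈ trigSpan K.deg := by
  rw [funext fun t => (K.hasDerivAt_num₂ t).deriv]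
  exact add_mem hK.isTrigPolynomial_deg.1.deriv.mem_trigSpan
    (Submodule.smul_mem _ Complex.I hK.isTrigPolynomial_deg.2.1.deriv.mem_trigSpan)

theorem Balanced.numWronskian_mem_trigSpan (hK : K.Balanced) :
    K.numWronskian ∈ trigSpan (K.deg + K.deg) :=
  sub_mem (mul_mem_trigSpan hK.num₁_mem_trigSpan hK.deriv_num₂_mem_trigSpan)
    (mul_mem_trigSpan hK.num₂_mem_trigSpan hK.deriv_num₁_mem_trigSpan)

theorem Balanced.ofReal_R_sq_mem_trigSpan (hK : K.Balanced) :
    (fun t => (K.R t : ℂ) ^ 2) ∈ trigSpan (K.deg * 2) := by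
  obtain ⟨hX, hY, hZ⟩ := hK.isTrigPolynomial_deg
  rw [funext K.ofReal_R_sq]
  exact add_mem (add_mem (add_mem (const_mem_trigSpan 1 _) (pow_mem_trigSpan hX.mem_trigSpan 2))
    (pow_mem_trigSpan hY.mem_trigSpan 2)) (pow_mem_trigSpan hZ.mem_trigSpan 2)

theorem Balanced.monomial_mem_trigSpan (hK : K.Balanced) {n i j : ℕ} (hi : i ≤ n) (hj : j ≤ n)
    (hij : Even (i + j)) :
    (fun t => (K.R t : ℂ) ^ (2 * n) * ((K.γ t).1 ^ i * (K.γ t).2 ^ j)) ∈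
      trigSpan (2 * K.deg * n) := by
  obtain ⟨k, hk⟩ := hij
  have hmem := mul_mem_trigSpan (pow_mem_trigSpan hK.ofReal_R_sq_mem_trigSpan (n - k))
    (mul_mem_trigSpan (pow_mem_trigSpan hK.num₁_mem_trigSpan i)
      (pow_mem_trigSpan hK.num₂_mem_trigSpan j))
  have hdeg : K.deg * 2 * (n - k) + (K.deg * i + K.deg * j) = 2 * K.deg * n := by
    rw [← mul_add, hk, ← two_mul, ← mul_assoc, ← mul_add, Nat.sub_add_cancel (by omega),
      mul_comm K.deg]
  rw [hdeg] at hmem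
  convert! hmem using 1
  funext t
  have hR := K.ofReal_R_ne_zero t
  have hexp : 2 * n = 2 * (n - k) + (i + j) := by omega
  simp only [Pi.mul_apply, Pi.pow_apply, K.γ_eq t, div_pow]
  rw [hexp, pow_add, pow_add, pow_mul]
  field_simp

theorem Balanced.targetH_mem_trigSpan (hK : K.Balanced) (part : FieldPart) {n : ℕ} (hn : 1 ≤ n) :
    (fun t => (K.R t : ℂ) ^ (2 * n) * targetH part K t) ∈ trigSpan (2 * K.deg * n) := by
  obtain ⟨m, rfl⟩ := Nat.exists_eq_add_of_le' hn
  have hmem := Submodule.smul_mem _ part.phase⁻¹ (mul_mem_trigSpan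
    (pow_mem_trigSpan hK.ofReal_R_sq_mem_trigSpan m)
    (star_mem_trigSpan hK.numWronskian_mem_trigSpan))
  have hdeg : K.deg * 2 * m + (K.deg + K.deg) = 2 * K.deg * (m + 1) := by ring
  rw [hdeg] at hmem
  convert! hmem using 1
  funext t
  have hR := K.ofReal_R_ne_zero t
  have htarget : targetH part K t = part.phase⁻¹ * (star (K.numWronskian t) / (K.R t : ℂ) ^ 2) := by
    rw [← phase_mul_targetH, inv_mul_cancel_left₀ part.phase_ne_zero]
  simp only [Pi.mul_apply, Pi.pow_apply, Pi.smul_apply, Pi.star_apply, smul_eq_mul, htarget]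
  rw [mul_add, pow_add, pow_mul]
  field_simp

end FourierCurve

/-! ## Closed field lines of Hopf type -/

theorem FourierCurve.Balanced.isClosedFieldLine_image {K : FourierCurve} (hK : K.Balanced)
    (hinj : InjOn K.γ (Ico 0 (2 * π))) {part : FieldPart} {h : ℂ × ℂ → ℂ}
    (hh : ∀ t, h (K.γ t) = targetH part K t) :
    IsClosedFieldLine (sphereField part h) K.image :=
  ⟨2 * π, K.γ, by positivity, fun t => sphereField_γ (hh t) ▸
    (K.hasDerivAt_γ t).differentiableAt.hasDerivAt, hK.periodic_γ, hinj, rfl⟩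

theorem FourierCurve.Balanced.isClosedFieldLine_preimage {K : FourierCurve} (hK : K.Balanced)
    (hinj : InjOn K.γ (Ico 0 (2 * π))) {part : FieldPart} {h : ℂ × ℂ → ℂ}
    (hh : ∀ t, h (K.γ t) = targetH part K t) (hinf : ((1, 0) : ℂ × ℂ) ∉ K.image) (t : ℝ) :
    IsClosedFieldLine (part.of (batemanField hopfα hopfβ h) t) (hopfMap t ⁻¹' K.image) := by
  refine (hK.isClosedFieldLine_image hinj hh).preimage (Ψ := hopfInv t) (ρ := hopfFactor t)
    (fun p => (hasFDerivAt_hopfMap t p).differentiableAt) ?_ (hopfInv_hopfMap t) ?_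
    (continuous_hopfFactor t) (hopfFactor_pos t) (fderiv_hopfMap_batemanField part h t)
  · rintro _ ⟨s, rfl⟩
    exact differentiableAt_hopfInv t (re_γ_ne_one hinf s)
  · rintro _ ⟨s, rfl⟩
    exact hopfMap_hopfInv t (K.normSq_γ s) (re_γ_ne_one hinf s)

theorem contDiff_sphereField (part : FieldPart) {h : ℂ × ℂ → ℂ} (hh : ContDiff ℝ ∞ h) :
    ContDiff ℝ ∞ (sphereField part h) := by
  have hconj : ContDiff ℝ ∞ (star : ℂ → ℂ) := Complex.conjCLE.contDiff
  have hv₁ : ContDiff ℝ ∞ v₁ := by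
    rw [funext v₁_eq]
    exact (hconj.comp contDiff_snd).neg.prodMk (hconj.comp contDiff_fst)
  exact (hconj.comp (contDiff_const.mul hh)).smul hv₁

theorem isBatemanFieldOfHopfType_batemanField {h : ℂ × ℂ → ℂ} (hh : Differentiable ℂ h) :
    IsBatemanFieldOfHopfType (batemanField hopfα hopfβ h) :=
  ⟨isBatemanPair_hopf, Set.univ, h, isOpen_univ, fun _ _ => mem_univ _, hh.differentiableOn,
    fun _ _ => rfl⟩

theorem isSphereField_sphereField (part : FieldPart) {h : ℂ × ℂ → ℂ} (hh : ContDiff ℝ ∞ h) :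
    IsSphereField (part.of (batemanField hopfα hopfβ h)) (sphereField part h) :=
  ⟨contDiff_sphereField part hh,
    fun t p => ⟨hopfFactor t p, hopfFactor_pos t p, fderiv_hopfMap_batemanField part h t p⟩⟩

theorem FourierLink.hasClosedFieldLines {l : ℕ} (L : FourierLink l) {part : FieldPart}
    {h : ℂ × ℂ → ℂ} (hh : ContDiff ℝ ∞ h)
    (hL : ∀ k t, h ((L.comp k).γ t) = targetH part (L.comp k) t) :
    HasClosedFieldLines (part.of (batemanField hopfα hopfβ h)) L :=
  ⟨⟨sphereField part h, isSphereField_sphereField part hh,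
    fun k => (L.balanced k).isClosedFieldLine_image (L.simple k) (hL k)⟩,
    fun t k hk => (L.balanced k).isClosedFieldLine_preimage (L.simple k) (hL k) hk t⟩

/-! ## Polynomials and linear systems -/

theorem contDiff_polyFun {𝕜 : Type*} [NontriviallyNormedField 𝕜] [NormedAlgebra 𝕜 ℂ]
    (G : MvPolynomial (Fin 2) ℂ) : ContDiff 𝕜 ∞ (polyFun G) := by
  refine AnalyticOnNhd.contDiff (AnalyticOnNhd.aeval_mvPolynomial (A := ℂ) (B := ℂ) ?_ G)
  intro i
  fin_cases i
  exacts [analyticOnNhd_fst, analyticOnNhd_snd]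

section Polynomials

variable {n : ℕ} (x : EvenIndex n → ℂ)

theorem polyFun_polyOf (z : ℂ × ℂ) :
    polyFun (polyOf x) z = ∑ p, x p * (z.1 ^ (p.1.1 : ℕ) * z.2 ^ (p.1.2 : ℕ)) := by
  simp [polyFun, polyOf, mul_assoc]

/-- The exponent vector of the monomial `z₁ⁱ z₂ʲ` with index `(i, j)`. -/
noncomputable def EvenIndex.exponent (p : EvenIndex n) : Fin 2 →₀ ℕ :=
  Finsupp.single 0 (p.1.1 : ℕ) + Finsupp.single 1 (p.1.2 : ℕ)

theorem EvenIndex.exponent_injective : Function.Injective (EvenIndex.exponent (n := n)) := by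
  intro p q h
  have h₀ := DFunLike.congr_fun h 0
  have h₁ := DFunLike.congr_fun h 1
  simp only [EvenIndex.exponent, Finsupp.add_apply, Finsupp.single_apply] at h₀ h₁
  exact Subtype.ext (Prod.ext (Fin.ext (by simpa using h₀)) (Fin.ext (by simpa using h₁)))

theorem polyOf_eq_sum_monomial : polyOf x = ∑ p, MvPolynomial.monomial p.exponent (x p) := by
  refine Finset.sum_congr rfl fun p _ => ?_
  rw [mul_assoc, MvPolynomial.X_pow_eq_monomial, MvPolynomial.X_pow_eq_monomial,
    MvPolynomial.monomial_mul, MvPolynomial.C_mul_monomial, mul_one, mul_one, EvenIndex.exponent]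

theorem coeff_polyOf (p : EvenIndex n) : (polyOf x).coeff p.exponent = x p := by
  classical
  simp only [polyOf_eq_sum_monomial, MvPolynomial.coeff_sum, MvPolynomial.coeff_monomial,
    EvenIndex.exponent_injective.eq_iff, Finset.sum_ite_eq', Finset.mem_univ, if_true]

theorem totalDegree_polyOf_le : (polyOf x).totalDegree ≤ 2 * n := by
  rw [polyOf_eq_sum_monomial]
  refine MvPolynomial.totalDegree_finsetSum_le fun p _ =>
    (MvPolynomial.totalDegree_monomial_le _ _).trans ?_
  rw [EvenIndex.exponent, Finsupp.sum_add_index' (fun _ => rfl) fun _ _ _ => rfl,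
    Finsupp.sum_single_index rfl, Finsupp.sum_single_index rfl]
  have h₁ := p.1.1.is_le
  have h₂ := p.1.2.is_le
  simp only [id]
  omega

variable {x}

theorem polyOf_ne_zero (hx : x ≠ 0) : polyOf x ≠ 0 := by
  intro h
  exact hx (funext fun p => by rw [← coeff_polyOf x p, h, MvPolynomial.coeff_zero, Pi.zero_apply])

end Polynomials

theorem FourierLink.exists_isExpansionMatrix {l : ℕ} (L : FourierLink l) (n : ℕ) :
    ∃ A : Matrix (Row L n) (EvenIndex n) ℂ, IsExpansionMatrix L n A := by
  choose v hv using fun (k : Fin l) (p : EvenIndex n) => exists_trigBasis_expansion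
    ((L.balanced k).monomial_mem_trigSpan p.1.1.is_le p.1.2.is_le p.2)
  refine ⟨fun r p => v r.1 p r.2, fun x k t => ?_⟩
  calc ((L.comp k).R t : ℂ) ^ (2 * n) * polyFun (polyOf x) ((L.comp k).γ t)
      = ∑ p, x p * ∑ r, v k p r * (trigBasis r t : ℂ) := by
        simp only [polyFun_polyOf, Finset.mul_sum (Finset.univ : Finset (EvenIndex n)), ← hv]
        exact Finset.sum_congr rfl fun p _ => mul_left_comm _ _ _
    _ = ∑ r, (∑ p, v k p r * x p) * (trigBasis r t : ℂ) := by
        simp only [Finset.mul_sum, Finset.sum_mul]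
        rw [Finset.sum_comm]
        exact Finset.sum_congr rfl fun r _ => Finset.sum_congr rfl fun p _ => by ring

theorem mul_half_le_card_evenIndex (n : ℕ) :
    (n + 1) * (n / 2) ≤ Fintype.card (EvenIndex n) := by
  have hinj : Function.Injective fun q : Fin (n + 1) × Fin (n / 2) =>
      (⟨(q.1, ⟨2 * q.2 + q.1 % 2, by omega⟩), by
        rw [Nat.even_iff]
        dsimp only
        omega⟩ : EvenIndex n) := by
    rintro ⟨i, j⟩ ⟨i', j'⟩ h
    simp only [Subtype.mk.injEq, Prod.mk.injEq, Fin.mk.injEq] at h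
    obtain ⟨rfl, hj⟩ := h
    exact Prod.ext rfl (Fin.ext (by dsimp only; omega))
  simpa using Fintype.card_le_of_injective _ hinj

theorem card_row {l : ℕ} (L : FourierLink l) (n : ℕ) :
    Fintype.card (Row L n) = 4 * (∑ k, (L.comp k).deg) * n + l := by
  have hk (k : Fin l) : 2 * (L.comp k).deg * n + 1 + 2 * (L.comp k).deg * n =
      4 * (L.comp k).deg * n + 1 := by ring
  simp [hk, Finset.sum_add_distrib, Finset.mul_sum, Finset.sum_mul]

theorem card_row_lt_card_evenIndex {l : ℕ} (L : FourierLink l) {n : ℕ}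
    (hn : 2 * (4 * (∑ k, (L.comp k).deg) + l + 1) ≤ n) :
    Fintype.card (Row L n) < Fintype.card (EvenIndex n) := by
  refine lt_of_lt_of_le ?_ (mul_half_le_card_evenIndex n)
  rw [card_row]
  set M := 4 * ∑ k, (L.comp k).deg
  have hhalf : M + l + 1 ≤ n / 2 := by omega
  calc M * n + l < (n + 1) * (M + l + 1) := by nlinarith
    _ ≤ (n + 1) * (n / 2) := Nat.mul_le_mul_left _ hhalf

theorem exists_mulVec_eq_zero_of_card_lt {r c 𝕜 : Type*} [Field 𝕜] [Fintype r] [Fintype c]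
    (A : Matrix r c 𝕜) (h : Fintype.card r < Fintype.card c) : ∃ x, x ≠ 0 ∧ A *ᵥ x = 0 := by
  have hker : LinearMap.ker A.mulVecLin ≠ ⊥ :=
    LinearMap.ker_ne_bot_of_finrank_lt (by simpa using h)
  obtain ⟨x, hx, hx₀⟩ := Submodule.exists_mem_ne_zero_of_ne_bot hker
  exact ⟨x, hx₀, hx⟩

theorem theorem2 {l : ℕ} (L : FourierLink l) :
    ∃ A : (n : ℕ) → Matrix (Row L n) (EvenIndex n) ℂ,
      (∀ n, IsExpansionMatrix L n (A n)) ∧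
      -- part (i)
      (∀ n, ∀ x : EvenIndex n → ℂ, x ≠ 0 → A n *ᵥ x = 0 →
        polyOf x ≠ 0 ∧ (polyOf x).totalDegree ≤ 2 * n ∧
          ∀ z ∈ L.carrier, polyFun (polyOf x) z = 0) ∧
      (∃ n₀, ∀ n, n₀ ≤ n → ∃ x : EvenIndex n → ℂ, x ≠ 0 ∧ A n *ᵥ x = 0) ∧
      -- part (ii)
      (∀ n, 1 ≤ n → ∀ part : FieldPart, ∃ y : Row L n → ℂ,
        IsTrigExpansion L
          (fun k t => ((L.comp k).R t : ℂ) ^ (2 * n) * targetH part (L.comp k) t) y ∧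
        ∀ x : EvenIndex n → ℂ, A n *ᵥ x = y →
          (polyOf x).totalDegree ≤ 2 * n ∧
          IsBatemanFieldOfHopfType (batemanField hopfα hopfβ (polyFun (polyOf x))) ∧
          HasClosedFieldLines (part.of (batemanField hopfα hopfβ (polyFun (polyOf x)))) L) := by
  choose A hA using L.exists_isExpansionMatrix
  have hR (n : ℕ) (k : Fin l) (t : ℝ) : ((L.comp k).R t : ℂ) ^ (2 * n) ≠ 0 :=
    pow_ne_zero _ ((L.comp k).ofReal_R_ne_zero t)
  refine ⟨A, hA, fun n x hx hAx => ⟨polyOf_ne_zero hx, totalDegree_polyOf_le x, ?_⟩,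
    ⟨_, fun n hn => exists_mulVec_eq_zero_of_card_lt (A n) (card_row_lt_card_evenIndex L hn)⟩,
    fun n hn part => ?_⟩
  · intro z hz
    obtain ⟨k, t, rfl⟩ := mem_iUnion.1 hz
    have hzero := hA n x k t
    simp only [hAx, Pi.zero_apply, zero_mul, Finset.sum_const_zero] at hzero
    exact (mul_eq_zero.1 hzero).resolve_left (hR n k t)
  · choose y hy using fun k => exists_trigBasis_expansion
      ((L.balanced k).targetH_mem_trigSpan part hn)
    refine ⟨fun r => y r.1 r.2, hy, fun x hx => ⟨totalDegree_polyOf_le x,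
      isBatemanFieldOfHopfType_batemanField ((contDiff_polyFun _).differentiable (by simp)),
      L.hasClosedFieldLines (contDiff_polyFun _) fun k t => mul_left_cancel₀ (hR n k t) ?_⟩⟩
    have hexp := hA n x k t
    rw [hx] at hexp
    exact hexp.trans (hy k t).symm
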